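/- Let $(X,\mu)$ be a standard probability space (a standard Borel space with a Borel probability measure), let $d\ge 0$ be an integer, and let $\mathcal G$ be a simple undirected graph on $X$ whose edge set is a Borel subset of $X^2$. Let $E_{\mathcal G}$ denote the equivalence relation on $X$ whose classes are the connected components of $\mathcal G$. Assume that $\mathcal G$ is - pmp: every Borel bijection $\theta:A\to B$ between Borel sets $A,B\subseteq X$ with $(x,\theta(x))\in E_{\mathcal G}$ for all $x\in A$ preserves $\mu$; - ergodic: every $E_{\mathcal G}$-invariant Borel set $A\subseteq X$ has $\mu(A)\in\{0,1\}$; - $d$-regular: $\mu$-almost every $x\in X$ has exactly $d$ neighbors. Then the formula $(T_{\mathcal G}f)(x)=\sum_{y\sim x}f(y)$ (for a.e. $x$) defines a bounded operator $T_{\mathcal G}$ on the complex Hilbert space $L^2(X,\mu)$. Let $\sigma(T_{\mathcal G})$ denote its spectrum, and assume moreover that $\mathcal G$ has spectral gap, i.e. there is $\varepsilon>0$ with $\sigma(T_{\mathcal G})\subseteq[-d,d-\varepsilon]\cup\{d\}$. Then: (a) If $-d\in\sigma(T_{\mathcal G})$, then $\mathcal G$ is approximately measurably bipartite, i.e. for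 every $\varepsilon>0$ there are disjoint $\mu$-measurable $\mathcal G$-independent sets $A,B\subseteq X$ with $\mu(A\cup B)>1-\varepsilon$. (b) The following are equivalent: 1. $\chi^{\mathrm{ap}}_\mu(\mathcal G)\le 2$; 2. $\mathcal G$ is approximately measurably bipartite; 3. $\sigma(T_{\mathcal G})$ is symmetric, i.e. $\lambda\in\sigma(T_{\mathcal G})$ implies $-\lambda\in\sigma(T_{\mathcal G})$; 4. $-d\in\sigma(T_{\mathcal G})$. Here $\chi^{\mathrm{ap}}_\mu(\mathcal G)$ is the least $k\in\mathbb N$ such that for every $\varepsilon>0$ there is a Borel set $A\subseteq X$ with $\mu(A)>1-\varepsilon$ for which the induced graph $\mathcal G\restriction A$ has a $\mu$-measurable proper $k$-coloring ($\infty$ if there is no such $k$). -/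

import Mathlib

open MeasureTheory

/-- A Borel graph: a simple graph whose edge relation is a Borel subset of `X × X`. -/
def IsBorelGraph {X : Type*} [MeasurableSpace X] (G : SimpleGraph X) : Prop :=
  MeasurableSet {p : X × X | G.Adj p.1 p.2}

/-- `G` is `μ`-pmp: every partial Borel bijection `θ : A → B` between Borel subsets of `X` whose
graph is contained in the connectedness relation of `G` preserves `μ`. Here
`μ.comap Subtype.val` is the restriction of `μ` to a Borel set, as a measure on that set. -/
def IsPMPGraph {X : Type*} [MeasurableSpace X] (G : SimpleGraph X) (μ : Measure X) : Prop :=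
  ∀ (A B : Set X), MeasurableSet A → MeasurableSet B → ∀ θ : A ≃ᵐ B,
    (∀ a : A, G.Reachable (a : X) (θ a : X)) →
      MeasurePreserving θ (μ.comap Subtype.val) (μ.comap Subtype.val)

/-- `G` is ergodic: every Borel set that is invariant under the connectedness relation of `G`
is null or conull. -/
def IsErgodicGraph {X : Type*} [MeasurableSpace X] (G : SimpleGraph X) (μ : Measure X) : Prop :=
  ∀ A : Set X, MeasurableSet A → (∀ x y, G.Reachable x y → (x ∈ A ↔ y ∈ A)) →
    μ A = 0 ∨ μ Aᶜ = 0

/-- `G` is `d`-regular: almost every vertex has exactly `d` neighbors (null sets are discarded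
throughout). -/
def IsRegularGraph {X : Type*} [MeasurableSpace X] (G : SimpleGraph X) (μ : Measure X)
    (d : ℕ) : Prop :=
  ∀ᵐ x ∂μ, (G.neighborSet x).encard = d

/-- The bounded operator `T` on the complex Hilbert space `L²(X, μ)` is given by the formula
`(T f)(x) = ∑_{y ∼ x} f(y)` for all `f` and almost every `x`. -/
def IsAdjacencyOperator {X : Type*} [MeasurableSpace X] (G : SimpleGraph X) (μ : Measure X)
    (T : Lp ℂ 2 μ →L[ℂ] Lp ℂ 2 μ) : Prop :=
  ∀ f : Lp ℂ 2 μ, T f =ᵐ[μ] fun x => ∑ᶠ y ∈ G.neighborSet x, f y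

/-- The defining formula determines the adjacency operator. -/
theorem IsAdjacencyOperator.unique {X : Type*} [MeasurableSpace X] {G : SimpleGraph X}
    {μ : Measure X} {S T : Lp ℂ 2 μ →L[ℂ] Lp ℂ 2 μ} (hS : IsAdjacencyOperator G μ S)
    (hT : IsAdjacencyOperator G μ T) : S = T :=
  ContinuousLinearMap.ext fun f => Lp.ext ((hS f).trans (hT f).symm)

open Classical in
/-- The adjacency operator `T_G` on `L²(X, μ)`, i.e. the unique bounded operator given by the
formula `(T f)(x) = ∑_{y ∼ x} f(y)`. If the formula does not define a bounded operator on
`L²(X, μ)` the value is `0`; `IsAdjacencyOperator G μ (adjacencyOperator G μ)` says that it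
does. -/
noncomputable def adjacencyOperator {X : Type*} [MeasurableSpace X] (G : SimpleGraph X)
    (μ : Measure X) : Lp ℂ 2 μ →L[ℂ] Lp ℂ 2 μ :=
  if h : ∃ T, IsAdjacencyOperator G μ T then h.choose else 0

/-- Spectral gap of a `d`-regular graph: `σ(T_G) ⊆ [-d, d - ε] ∪ {d}` for some `ε > 0`. -/
def HasSpectralGap {X : Type*} [MeasurableSpace X] (G : SimpleGraph X) (μ : Measure X)
    (d : ℕ) : Prop :=
  ∃ ε : ℝ, 0 < ε ∧ spectrum ℂ (adjacencyOperator G μ) ⊆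
    (fun r : ℝ => (r : ℂ)) '' (Set.Icc (-(d : ℝ)) ((d : ℝ) - ε) ∪ {(d : ℝ)})

/-- `σ(T_G)` is symmetric about `0`. -/
def HasSymmetricSpectrum {X : Type*} [MeasurableSpace X] (G : SimpleGraph X)
    (μ : Measure X) : Prop :=
  ∀ z ∈ spectrum ℂ (adjacencyOperator G μ), -z ∈ spectrum ℂ (adjacencyOperator G μ)

/-- `G` is approximately measurably bipartite: for every `ε > 0` there are disjoint
`μ`-measurable `G`-independent sets `A`, `B` with `μ(A ∪ B) > 1 - ε`. -/
def IsApproxMeasurablyBipartite {X : Type*} [MeasurableSpace X] (G : SimpleGraph X)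
    (μ : Measure X) : Prop :=
  ∀ ε : ℝ, 0 < ε → ∃ A B : Set X, NullMeasurableSet A μ ∧ NullMeasurableSet B μ ∧
    Disjoint A B ∧ G.IsIndepSet A ∧ G.IsIndepSet B ∧ 1 - ε < μ.real (A ∪ B)

/-- For every `ε > 0` there is a Borel set `A` with `μ(A) > 1 - ε` such that the induced graph
`G ↾ A` has a `μ`-measurable proper coloring with `k` colors. -/
def IsApproxMeasurablyColorable {X : Type*} [MeasurableSpace X] (G : SimpleGraph X)
    (μ : Measure X) (k : ℕ) : Prop :=
  ∀ ε : ℝ, 0 < ε → ∃ A : Set X, MeasurableSet A ∧ 1 - ε < μ.real A ∧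
    ∃ c : (G.induce A).Coloring (Fin k),
      ∀ i : Fin k, NullMeasurableSet (Subtype.val '' {a : A | c a = i}) μ

/-- The approximate `μ`-measurable chromatic number: the least `k` as above, and `⊤` if there is
no such `k`. -/
noncomputable def approxMeasurableChromaticNumber {X : Type*} [MeasurableSpace X]
    (G : SimpleGraph X) (μ : Measure X) : ℕ∞ :=
  ⨅ k ∈ {k : ℕ | IsApproxMeasurablyColorable G μ k}, (k : ℕ∞)

/-! Let M be the measure on oriented edges obtained by following each of the d edges out of a
μ-random vertex. The pmp condition makes M invariant under reversal, so both marginals are d μ, T is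
self-adjoint, and ∫ |f(x) ± f(y)|² dM = 2(d‖f‖² ± ⟨f, Tf⟩) (`integral_norm_add_smul_sq`).

If -d is a spectral value, T + d is not coercive, so some real r of norm 1 has ∫ (r(x) + r(y))² dM
tiny. Since ||r(x)| - |r(y)|| ≤ |r(x) + r(y)|, the energy of |r| is tiny too. By ergodicity only
constants have eigenvalue d, and the gap turns this into a Poincaré inequality (`poincare_of_gap`),
which forces |r| to be nearly constant. The sign of r then splits almost all of X in two; the few
vertices with an edge along which r does not nearly change sign are dropped.

Conversely, the sign function u of a near-bipartition almost anticommutes with T (`exists_sign`), so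
multiplication by u turns approximate eigenvectors for z into ones for -z and the spectrum is
symmetric. Constants have eigenvalue d, whence -d is a spectral value.

Beneath this lies a measure-theoretic point. Regularity holds only almost everywhere, and vertices
of the exceptional null set may have uncountably many neighbors.
`IsPMPGraph.measure_eq_zero_of_mapsTo_null` shows that almost no vertex is adjacent to a given null
set, so all work takes place on a conull Borel union of components. -/

/-! ### Pmp graphs: maps along components and null sets -/

/-- Injective Borel maps on standard Borel spaces are embeddings, so matching points with equal
labels is a Borel bijection along components. -/
theorem IsPMPGraph.measure_eq_of_image_eq {X Z : Type*} [MeasurableSpace X] [StandardBorelSpace X]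
    [MeasurableSpace Z] [MeasurableSpace.CountablySeparated Z] {G : SimpleGraph X} {μ : Measure X}
    (hpmp : IsPMPGraph G μ) {A B : Set X} (hA : MeasurableSet A) (hB : MeasurableSet B)
    {k l : X → Z} (hk : Measurable k) (hl : Measurable l) (hkA : Set.InjOn k A)
    (hlB : Set.InjOn l B) (him : k '' A = l '' B)
    (hr : ∀ x ∈ A, ∀ y ∈ B, k x = l y → G.Reachable x y) : μ A = μ B := by
  have := hA.standardBorel
  have := hB.standardBorel
  have ek : MeasurableEmbedding (fun a : A => k a) :=
    (hk.comp measurable_subtype_coe).measurableEmbedding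
      fun a b h => Subtype.ext (hkA a.2 b.2 h)
  have el : MeasurableEmbedding (fun b : B => l b) :=
    (hl.comp measurable_subtype_coe).measurableEmbedding
      fun a b h => Subtype.ext (hlB a.2 b.2 h)
  have hrange : Set.range (fun a : A => k a) = Set.range (fun b : B => l b) := by
    rw [← Set.image_eq_range, ← Set.image_eq_range, him]
  let c : Set.range (fun a : A => k a) ≃ᵐ Set.range (fun b : B => l b) :=
    { toEquiv := Equiv.setCongr hrange
      measurable_toFun := measurable_subtype_coe.subtype_mk
      measurable_invFun := measurable_subtype_coe.subtype_mk }
  let θ : A ≃ᵐ B := (ek.equivRange.trans c).trans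
    el.equivRange.symm
  have hθ (a : A) : k a = l (θ a) := by
    have : el.equivRange (θ a) = c (ek.equivRange a) := by
      simp [θ]
    have := congrArg Subtype.val this
    simpa [MeasurableEmbedding.equivRange_apply, c] using! this.symm
  have hmp := hpmp A B hA hB θ fun a => hr a a.2 (θ a) (θ a).2 (hθ a)
  have h := hmp.measure_preimage_equiv Set.univ
  rw [Set.preimage_univ, comap_subtype_coe_apply hA, comap_subtype_coe_apply hB] at h
  simpa using h

theorem IsPMPGraph.measure_image_eq {X : Type*} [MeasurableSpace X] [StandardBorelSpace X]
    {G : SimpleGraph X} {μ : Measure X}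
    (hpmp : IsPMPGraph G μ) {A : Set X} (hA : MeasurableSet A)
    {k : X → X} (hk : Measurable k) (hkA : Set.InjOn k A)
    (hr : ∀ x ∈ A, G.Reachable x (k x)) : μ (k '' A) = μ A :=
  (hpmp.measure_eq_of_image_eq hA (hA.image_of_measurable_injOn hk hkA) hk measurable_id hkA
    Function.injective_id.injOn (by simp) fun x hx y _ h => (show k x = y from h) ▸ hr x hx).symm

open ProbabilityTheory Set Filter Topology in
/-- Probability integral transform. -/
theorem map_cdf_eq_uniform (κ : Measure ℝ) [IsProbabilityMeasure κ] [NullSingletonClass κ] :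
    κ.map (cdf κ) = volume.restrict (Icc 0 1) := by
  have hm : Measurable (cdf κ) := (monotone_cdf κ).measurable
  have hc : Continuous (cdf κ) := by
    rw [continuous_iff_continuousAt]
    intro x
    rw [(monotone_cdf κ).continuousAt_iff_leftLim_eq_rightLim, StieltjesFunction.rightLim_eq]
    have h := (cdf κ).measure_singleton x
    rw [measure_cdf, measure_singleton, eq_comm, ENNReal.ofReal_eq_zero] at h
    exact le_antisymm ((monotone_cdf κ).leftLim_le le_rfl) (by linarith)
  have hex {u : ℝ} (h0 : 0 < u) (h1 : u < 1) : ∃ t, cdf κ t = u := by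
    obtain ⟨a, ha⟩ := ((tendsto_cdf_atBot κ).eventually (gt_mem_nhds h0)).exists
    obtain ⟨b, hb⟩ := ((tendsto_cdf_atTop κ).eventually (lt_mem_nhds h1)).exists
    exact mem_range_of_exists_le_of_exists_ge hc ⟨a, ha.le⟩ ⟨b, hb.le⟩
  have hle {u : ℝ} (h0 : 0 < u) (h1 : u < 1) : ENNReal.ofReal u ≤ κ {t | cdf κ t ≤ u} := by
    obtain ⟨t, rfl⟩ := hex h0 h1
    rw [ofReal_cdf]
    exact measure_mono fun s hs => monotone_cdf κ hs
  have hlt {u : ℝ} (h0 : 0 < u) (h1 : u < 1) : κ {t | cdf κ t < u} ≤ ENNReal.ofReal u := by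
    obtain ⟨t, rfl⟩ := hex h0 h1
    rw [ofReal_cdf]
    exact measure_mono fun s hs => le_of_lt ((monotone_cdf κ).reflect_lt hs)
  have := Measure.isProbabilityMeasure_map (μ := κ) hm.aemeasurable
  refine Measure.ext_of_Iic _ _ fun u => ?_
  rw [Measure.map_apply hm measurableSet_Iic, Measure.restrict_apply measurableSet_Iic]
  -- The strict bound `hlt` at v > u, with v decreasing to u.
  have hle' {u : ℝ} (h0 : 0 ≤ u) (h1 : u < 1) : κ {t | cdf κ t ≤ u} ≤ ENNReal.ofReal u := by
    have : ∀ᶠ v in 𝓝[>] u, κ {t | cdf κ t ≤ u} ≤ ENNReal.ofReal v := by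
      filter_upwards [Ioo_mem_nhdsGT h1] with v hv
      exact (measure_mono fun t ht => lt_of_le_of_lt ht hv.1).trans (hlt (h0.trans_lt hv.1) hv.2)
    exact ge_of_tendsto ((ENNReal.continuous_ofReal.tendsto u).mono_left nhdsWithin_le_nhds) this
  rcases lt_or_ge u 0 with h0 | h0
  · have h1 : cdf κ ⁻¹' Iic u = ∅ := by
      ext t; simpa using h0.trans_le (cdf_nonneg κ t)
    have h2 : Iic u ∩ Icc 0 1 = ∅ := by
      ext t; simp; intro h h'; linarith
    rw [h1, h2]; simp
  rcases le_or_gt 1 u with h1 | h1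
  · have h1' : cdf κ ⁻¹' Iic u = univ := by
      ext t; simpa using (cdf_le_one κ t).trans h1
    have h2 : Iic u ∩ Icc 0 1 = Icc 0 1 := inter_eq_right.2 fun t ht => ht.2.trans h1
    rw [h1', h2]; simp
  · have h2 : Iic u ∩ Icc 0 1 = Icc 0 u := by
      ext t; simp; constructor
      · tauto
      · rintro ⟨h, h'⟩; exact ⟨h', h, by linarith⟩
    rw [h2, Real.volume_Icc, sub_zero]
    refine le_antisymm (hle' h0 h1) ?_
    rcases h0.eq_or_lt with rfl | h0
    · simp
    · exact hle h0 h1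

open ProbabilityTheory Set in
/-- If `ρ` gives measure zero to every Borel set meeting each fiber of the first projection in at
most one point, then almost all of its conditional measures have no atoms. -/
theorem ae_condKernel_nullSingletonClass {X : Type*} [MeasurableSpace X]
    (ρ : Measure (X × ℝ)) [IsFiniteMeasure ρ]
    (h : ∀ D : Set (X × ℝ), MeasurableSet D → InjOn Prod.fst D → ρ D = 0) :
    ∀ᵐ y ∂ρ.fst, NullSingletonClass (ρ.condKernel y) := by
  set κ := ρ.condKernel
  -- Points carrying more than half the conditional mass of the interval (p, q). A fiber has at most
  -- one of them, and by outer regularity every atom is such a point for some rational p, q.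
  let D (p q : ℚ) : Set (X × ℝ) :=
    {z | z.2 ∈ Ioo (p : ℝ) q ∧ (κ z.1).real (Ioo (p : ℝ) q) < 2 * (κ z.1).real {z.2}}
  have hsing : Measurable fun z : X × ℝ => (κ z.1).real {z.2} := by
    have hS : MeasurableSet {w : (X × ℝ) × ℝ | w.2 = w.1.2} :=
      measurableSet_eq_fun measurable_snd measurable_fst.snd
    exact (Kernel.measurable_kernel_prodMk_left (κ := κ.comap Prod.fst measurable_fst)
      hS).ennreal_toReal
  have hD (p q : ℚ) : MeasurableSet (D p q) := by
    have : D p q = Prod.snd ⁻¹' Ioo (p : ℝ) q ∩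
        {z | (κ z.1).real (Ioo (p : ℝ) q) < 2 * (κ z.1).real {z.2}} := rfl
    rw [this]
    refine (measurable_snd measurableSet_Ioo).inter (measurableSet_lt ?_ ?_)
    · exact ((κ.measurable_coe measurableSet_Ioo).comp measurable_fst).ennreal_toReal
    · exact hsing.const_mul 2
  have hD0 (p q : ℚ) : ρ (D p q) = 0 := by
    refine h _ (hD p q) ?_
    rintro ⟨y, s⟩ ⟨hs, hs'⟩ ⟨y', t⟩ ⟨ht, ht'⟩ (rfl : y = y')
    by_contra hne
    have hst : s ≠ t := fun h => hne (by rw [h])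
    have h1 : (κ y).real {s} + (κ y).real {t} ≤ (κ y).real (Ioo (p : ℝ) q) := by
      rw [← measureReal_union (by simpa using hst) (measurableSet_singleton t)]
      refine measureReal_mono ?_
      rintro x (rfl | rfl)
      · exact hs
      · exact ht
    simp only at hs' ht'
    linarith
  have hae : ∀ᵐ z ∂ρ, κ z.1 {z.2} = 0 := by
    have : ∀ᵐ z ∂ρ, ∀ p q, z ∉ D p q := by
      rw [ae_all_iff]; intro p; rw [ae_all_iff]; intro q
      exact measure_eq_zero_iff_ae_notMem.1 (hD0 p q)
    filter_upwards [this] with z hz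
    by_contra hpos
    have hlt : κ z.1 {z.2} < 2 * κ z.1 {z.2} := by
      rw [two_mul]
      exact ENNReal.lt_add_right (measure_ne_top _ _) hpos
    obtain ⟨U, hU, hUo, hU'⟩ := exists_isOpen_lt_of_lt _ _ hlt
    obtain ⟨V, hV, hzV, hVU⟩ := Real.isTopologicalBasis_Ioo_rat.exists_subset_of_mem_open
      (hU rfl) hUo
    simp only [mem_iUnion, mem_singleton_iff] at hV
    obtain ⟨p, q, -, rfl⟩ := hV
    refine hz p q ⟨hzV, ?_⟩
    have := (measure_mono hVU).trans_lt hU'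
    have h2 := ENNReal.toReal_strict_mono
      (ENNReal.mul_ne_top ENNReal.ofNat_ne_top (measure_ne_top _ _)) this
    simpa [measureReal_def] using h2
  rw [← ρ.disintegrate κ] at hae
  filter_upwards [Measure.ae_ae_of_ae_compProd hae] with y hy
  refine ⟨fun t => ?_⟩
  by_contra hpos
  exact hpos (measure_mono_null (fun s hs => by rw [mem_singleton_iff.1 hs]; exact hpos)
    (ae_iff.1 hy))

open ProbabilityTheory Set in
/-- A Borel map along components of a pmp graph sends no set of positive measure into a null set.
If the map is injective on no set of positive measure, then the conditional measures along its
fibers are atomless, and the fibers can be compressed by a factor of two. -/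
theorem IsPMPGraph.measure_eq_zero_of_mapsTo_null {X : Type*} [MeasurableSpace X]
    [StandardBorelSpace X] {G : SimpleGraph X} {μ : Measure X} [IsFiniteMeasure μ]
    (hpmp : IsPMPGraph G μ) {A N : Set X} (hA : MeasurableSet A) {f : X → X} (hf : Measurable f)
    (hr : ∀ x ∈ A, G.Reachable x (f x)) (hN : μ N = 0) (hAN : MapsTo f A N) : μ A = 0 := by
  have hinj (B : Set X) (hB : MeasurableSet B) (hBA : B ⊆ A) (hfB : InjOn f B) : μ B = 0 := by
    rw [← hpmp.measure_image_eq hB hf hfB fun x hx => hr x (hBA hx)]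
    exact measure_mono_null (image_subset_iff.2 fun x hx => hAN (hBA hx)) hN
  have he := measurableEmbedding_embeddingReal X
  set e := embeddingReal X
  let g (x : X) : X × ℝ := (f x, e x)
  have hg : Measurable g := hf.prodMk he.measurable
  set ρ := (μ.restrict A).map g with hρ
  have hρA {S : Set (X × ℝ)} (hS : MeasurableSet S) : ρ S = μ (A ∩ g ⁻¹' S) := by
    rw [hρ, Measure.map_apply hg hS, Measure.restrict_apply (hg hS), inter_comm]
  have hat := ae_condKernel_nullSingletonClass ρ fun D hD hDi => by
    rw [hρA hD]
    exact hinj _ (hA.inter (hg hD)) inter_subset_left fun x hx y hy hxy =>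
      he.injective (congrArg Prod.snd (hDi hx.2 hy.2 hxy))
  set κ := ρ.condKernel
  have hdis : ρ.fst ⊗ₘ κ = ρ := ρ.disintegrate κ
  let lam : Measure ℝ := volume.restrict (Icc 0 1)
  have hunif : ∀ᵐ y ∂ρ.fst, (κ y).map (cdf (κ y)) = lam := by
    filter_upwards [hat] with y hy
    exact map_cdf_eq_uniform (κ y)
  have hcm (y : X) : Measurable (cdf (κ y)) := (monotone_cdf (κ y)).measurable
  have hF : Measurable fun z : X × ℝ => cdf (κ z.1) z.2 := by
    have hS : MeasurableSet {w : (X × ℝ) × ℝ | w.2 ≤ w.1.2} :=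
      measurableSet_le measurable_snd measurable_fst.snd
    simp_rw [cdf_eq_real]
    exact (Kernel.measurable_kernel_prodMk_left (κ := κ.comap Prod.fst measurable_fst)
      hS).ennreal_toReal
  -- The cdf on each fiber straightens the conditional measures to Lebesgue measure on [0, 1].
  let h (z : X × ℝ) : X × ℝ := (z.1, cdf (κ z.1) z.2)
  have hh : Measurable h := measurable_fst.prodMk hF
  let k (x : X) : X × ℝ := h (g x)
  have hk : Measurable k := hh.comp hg
  let m : Measure (X × ℝ) := ρ.fst.prod lam
  have hmap : ρ.map h = m := by
    ext S hS
    rw [Measure.map_apply hh hS, ← hdis, Measure.compProd_apply (hh hS),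
      Measure.prod_apply hS]
    refine lintegral_congr_ae ?_
    filter_upwards [hunif] with y hy
    rw [← hy, Measure.map_apply (hcm y) (measurable_prodMk_left hS)]
    rfl
  have hmA {S : Set (X × ℝ)} (hS : MeasurableSet S) : m S = μ (A ∩ k ⁻¹' S) := by
    rw [← hmap, Measure.map_apply hh hS, hρA (hh hS)]
    rfl
  -- Two points of a fiber with the same cdf value have a rational between them with that value as
  -- well; removing these null sets makes `k` injective.
  let W (q : ℚ) : Set (X × ℝ) := {z | cdf (κ z.1) z.2 = cdf (κ z.1) q}
  have hW (q : ℚ) : MeasurableSet (W q) :=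
    measurableSet_eq_fun hF (hF.comp (measurable_fst.prodMk measurable_const))
  have hW0 (q : ℚ) : ρ (W q) = 0 := by
    rw [← hdis, Measure.compProd_apply (hW q)]
    refine (lintegral_congr_ae ?_).trans lintegral_zero
    filter_upwards [hunif] with y hy
    have : Prod.mk y ⁻¹' W q = cdf (κ y) ⁻¹' {cdf (κ y) q} := rfl
    rw [this, ← Measure.map_apply (hcm y) (measurableSet_singleton _), hy]
    exact measure_singleton _
  let A' : Set X := A \ g ⁻¹' ⋃ q, W q
  have hA' : MeasurableSet A' := hA.diff (hg (MeasurableSet.iUnion hW))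
  have hA'0 : μ (A \ A') = 0 := by
    have : A \ A' = A ∩ g ⁻¹' ⋃ q, W q := by simp [A']
    rw [this, ← hρA (MeasurableSet.iUnion hW)]
    exact measure_iUnion_null hW0
  have hkA' : InjOn k A' := by
    have key (x y : X) (hx : x ∈ A') (hfxy : f x = f y)
        (hc : cdf (κ (f x)) (e x) = cdf (κ (f x)) (e y)) : ¬ e x < e y := by
      intro hlt
      obtain ⟨q, hq, hq'⟩ := exists_rat_btwn hlt
      refine hx.2 (mem_iUnion.2 ⟨q, ?_⟩)
      exact le_antisymm (monotone_cdf _ hq.le) (hc ▸ monotone_cdf (κ (f x)) hq'.le)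
    intro x hx y hy hxy
    have hfxy : f x = f y := congrArg Prod.fst hxy
    have hc : cdf (κ (f x)) (e x) = cdf (κ (f x)) (e y) := by
      conv_rhs => rw [hfxy]
      exact congrArg Prod.snd hxy
    refine he.injective (le_antisymm (not_lt.1 (key y x hy hfxy.symm ?_))
      (not_lt.1 (key x y hx hfxy hc)))
    rw [← hfxy, hc]
  let I : Set (X × ℝ) := k '' A'
  have hI : MeasurableSet I := hA'.image_of_measurable_injOn hk hkA'
  have hmI : m Iᶜ = 0 := by
    rw [hmA hI.compl]
    have hsub : A ∩ k ⁻¹' Iᶜ ⊆ A \ A' := fun x hx => ⟨hx.1, fun hx' => hx.2 ⟨x, hx', rfl⟩⟩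
    exact measure_mono_null hsub hA'0
  -- Halving the fiber coordinate induces a Borel injection along components, from almost all of `A`
  -- into a part of `A` with at most half the measure.
  let φ (z : X × ℝ) : X × ℝ := (z.1, z.2 / 2)
  have hφ : Measurable φ := by fun_prop
  have hφi : Function.Injective φ := by
    rintro ⟨a, b⟩ ⟨c, d⟩ hab
    simp only [φ, Prod.mk.injEq] at hab
    ext
    · exact hab.1
    · simp only; linarith [hab.2]
  have hlam : lam.map (fun t => t / 2) ≪ lam := by
    intro S hS
    have hd : Measurable fun t : ℝ => t / 2 := by fun_prop
    obtain ⟨S', hSS', hS', hS0⟩ := exists_measurable_superset_of_null hS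
    refine measure_mono_null hSS' ?_
    rw [Measure.map_apply hd hS', Measure.restrict_apply (hd hS')]
    rw [Measure.restrict_apply hS'] at hS0
    have hsub : (fun t : ℝ => t / 2) ⁻¹' S' ∩ Icc 0 1 ⊆
        (fun t : ℝ => 2⁻¹ * t) ⁻¹' (S' ∩ Icc 0 1) := by
      rintro t ⟨ht, h0, h1⟩
      have ht' : t / 2 ∈ S' := ht
      rw [div_eq_inv_mul] at ht'
      exact ⟨ht', by simp only; linarith, by simp only; linarith⟩
    refine measure_mono_null hsub ?_
    rw [Real.volume_preimage_mul_left (by norm_num), hS0, mul_zero]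
  have hmφ : m (φ ⁻¹' Iᶜ) = 0 := by
    have h1 : m.map φ = ρ.fst.prod (lam.map fun t => t / 2) := by
      have := Measure.map_prod_map ρ.fst lam measurable_id
        (show Measurable fun t : ℝ => t / 2 by fun_prop)
      rw [Measure.map_id] at this
      exact this.symm
    have h2 : m.map φ ≪ m := by
      rw [h1]
      exact Measure.AbsolutelyContinuous.rfl.prod hlam
    rw [← Measure.map_apply hφ hI.compl]
    exact h2 hmI
  let C : Set X := A' ∩ k ⁻¹' (φ ⁻¹' I)
  have hC : MeasurableSet C := hA'.inter (hk (hφ hI))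
  have hφk : InjOn (fun x => φ (k x)) C := fun x hx y hy hxy => hkA' hx.1 hy.1 (hφi hxy)
  have hJ : MeasurableSet ((fun x => φ (k x)) '' C) :=
    hC.image_of_measurable_injOn (hφ.comp hk) hφk
  let B : Set X := A' ∩ k ⁻¹' ((fun x => φ (k x)) '' C)
  have hCB : μ C = μ B := by
    refine hpmp.measure_eq_of_image_eq hC (hA'.inter (hk hJ)) (hφ.comp hk) hk hφk
      (hkA'.mono inter_subset_left) ?_ ?_
    · ext z
      constructor
      · rintro ⟨x, hx, rfl⟩
        obtain ⟨y, hy, hyx⟩ := hx.2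
        refine ⟨y, ⟨hy, ?_⟩, hyx⟩
        rw [mem_preimage, hyx]
        exact ⟨x, hx, rfl⟩
      · rintro ⟨y, hy, rfl⟩
        exact hy.2
    · intro x hx y hy hxy
      have hfxy : f x = f y := congrArg Prod.fst hxy
      exact (hr x hx.1.1).trans (hfxy ▸ (hr y hy.1.1).symm)
  have hAC : μ A ≤ μ C := by
    have hsub : A ⊆ C ∪ ((A \ A') ∪ (A ∩ k ⁻¹' (φ ⁻¹' Iᶜ))) := by
      intro x hx
      by_cases h1 : x ∈ A'
      · by_cases h2 : φ (k x) ∈ I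
        · exact Or.inl ⟨h1, h2⟩
        · exact Or.inr (Or.inr ⟨hx, h2⟩)
      · exact Or.inr (Or.inl ⟨hx, h1⟩)
    refine (measure_mono hsub).trans ((measure_union_le _ _).trans ?_)
    rw [measure_union_null hA'0 (by rw [← hmA (hφ hI.compl)]; exact hmφ), add_zero]
  have hBA : μ B ≤ μ A * ENNReal.ofReal (1 / 2) := by
    have hsub : B ⊆ A ∩ k ⁻¹' (univ ×ˢ Iic (1 / 2 : ℝ)) := by
      rintro x ⟨hx, y, hy, hyx⟩
      refine ⟨hx.1, mem_univ _, ?_⟩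
      rw [← hyx]
      have : (k y).2 ≤ 1 := cdf_le_one _ _
      change (k y).2 / 2 ≤ 1 / 2
      linarith
    refine (measure_mono hsub).trans ?_
    have hl : lam (Iic (1 / 2)) = ENNReal.ofReal (1 / 2) := by
      rw [Measure.restrict_apply measurableSet_Iic]
      have : Iic (1 / 2 : ℝ) ∩ Icc 0 1 = Icc 0 (1 / 2) := by
        ext t
        simp only [mem_inter_iff, mem_Iic, mem_Icc]
        constructor
        · tauto
        · rintro ⟨h, h'⟩; exact ⟨h', h, by linarith⟩
      rw [this, Real.volume_Icc, sub_zero]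
    have hu : ρ.fst univ = μ A := by
      rw [Measure.fst_univ, hρA MeasurableSet.univ]; simp
    rw [← hmA (MeasurableSet.univ.prod measurableSet_Iic), Measure.prod_prod, hl, hu]
  have hfin := (hAC.trans hCB.le).trans hBA
  by_contra hne
  have h1 := ENNReal.toReal_mono
    (ENNReal.mul_ne_top (measure_ne_top μ A) ENNReal.ofReal_ne_top) hfin
  rw [ENNReal.toReal_mul, ENNReal.toReal_ofReal (by norm_num)] at h1
  have h2 := ENNReal.toReal_pos hne (measure_ne_top μ A)
  linarith

/-! ### Borel enumeration of neighbors on a conull union of components -/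

open Set in
/-- Finite neighborhoods of constant size admit a Borel enumeration (via Lusin–Souslin). -/
theorem IsBorelGraph.exists_measurable_enumeration {X : Type*} [MeasurableSpace X]
    [StandardBorelSpace X] {G : SimpleGraph X} (hG : IsBorelGraph G) {d : ℕ} {Y : Set X}
    (hY : MeasurableSet Y) (hd : ∀ x ∈ Y, (G.neighborSet x).encard = d) :
    ∃ nb : X → Fin d → X, Measurable nb ∧ ∀ x ∈ Y, Function.Injective (nb x) ∧
      range (nb x) = G.neighborSet x := by
  have he := measurableEmbedding_embeddingReal X
  set e := embeddingReal X
  -- Listing the neighbors in increasing order of their real codes makes the list unique, so `H`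
  -- projects injectively to X and the inverse of the projection is Borel.
  let H : Set (X × (Fin d → X)) :=
    Prod.fst ⁻¹' Y ∩ ((⋂ i, {p | G.Adj p.1 (p.2 i)}) ∩ ⋂ i, ⋂ j, {p | i < j → e (p.2 i) < e (p.2 j)})
  have hH : MeasurableSet H := by
    refine (measurable_fst hY).inter (.inter (.iInter fun i => ?_)
      (.iInter fun i => .iInter fun j => ?_))
    · exact (show Measurable fun p : X × (Fin d → X) => (p.1, p.2 i) by fun_prop) hG
    · by_cases hij : i < j
      · simp only [hij, true_imp_iff]
        exact measurableSet_lt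
          (he.measurable.comp ((measurable_pi_apply i).comp measurable_snd))
          (he.measurable.comp ((measurable_pi_apply j).comp measurable_snd))
      · simp [hij]
  have hmem {x : X} {t : Fin d → X} (h : (x, t) ∈ H) :
      StrictMono (e ∘ t) ∧ Function.Injective t ∧ range t = G.neighborSet x := by
    have hsm : StrictMono (e ∘ t) := fun i j hij => mem_iInter.1 (mem_iInter.1 h.2.2 i) j hij
    have hti : Function.Injective t := hsm.injective.of_comp
    have hsub : range t ⊆ G.neighborSet x := by
      rintro _ ⟨i, rfl⟩
      exact mem_iInter.1 h.2.1 i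
    have hc : (range t).encard = d := by
      rw [← image_univ, hti.encard_image, encard_univ]; simp
    refine ⟨hsm, hti, Finite.eq_of_subset_of_encard_le' (s := range t) ?_ hsub ?_⟩
    · exact finite_of_encard_eq_coe (hd x h.1)
    rw [hc, hd x h.1]
  have hex {x : X} (hx : x ∈ Y) : ∃ t, (x, t) ∈ H := by
    have hfin : (G.neighborSet x).Finite := finite_of_encard_eq_coe (hd x hx)
    have hcard : (hfin.image e).toFinset.card = d := by
      rw [← ncard_eq_toFinset_card _ (hfin.image e), ncard_image_of_injective _ he.injective, ncard, hd x hx]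
      rfl
    let o := (hfin.image e).toFinset.orderEmbOfFin hcard
    have ho (i : Fin d) : ∃ y ∈ G.neighborSet x, e y = o i := by
      have := (hfin.image e).toFinset.orderEmbOfFin_mem hcard i
      rwa [Finite.mem_toFinset] at this
    choose t ht hto using ho
    refine ⟨t, hx, mem_iInter.2 ht, mem_iInter.2 fun i => mem_iInter.2 fun j hij => ?_⟩
    change e (t i) < e (t j)
    rw [hto, hto]
    exact o.strictMono hij
  rcases isEmpty_or_nonempty H with hemp | hne
  · refine ⟨fun x _ => x, by fun_prop, fun x hx => ?_⟩
    obtain ⟨t, ht⟩ := hex hx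
    exact (hemp.false ⟨_, ht⟩).elim
  have := hH.standardBorel
  have hemb : MeasurableEmbedding (fun p : H => p.1.1) := by
    refine (measurable_fst.comp measurable_subtype_coe).measurableEmbedding ?_
    rintro ⟨⟨x, t⟩, h⟩ ⟨⟨y, s⟩, h'⟩ (rfl : x = y)
    have hr : range (e ∘ t) = range (e ∘ s) := by
      rw [range_comp, range_comp, (hmem h).2.2, (hmem h').2.2]
    have := ((hmem h).1.range_inj (hmem h').1).1 hr
    have hts : t = s := he.injective.comp_left this
    subst hts
    rfl
  refine ⟨fun x => (hemb.invFun x).1.2,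
    measurable_snd.comp (measurable_subtype_coe.comp hemb.measurable_invFun), fun x hx => ?_⟩
  obtain ⟨t, ht⟩ := hex hx
  have := hemb.leftInverse_invFun ⟨_, ht⟩
  simp only at this ⊢
  rw [this]
  exact (hmem ht).2

open Set in
theorem exists_measurableSet_subset_conull {X : Type*} [MeasurableSpace X] {μ : Measure X}
    {p : X → Prop} (h : ∀ᵐ x ∂μ, p x) :
    ∃ Y, MeasurableSet Y ∧ (∀ᵐ x ∂μ, x ∈ Y) ∧ ∀ x ∈ Y, p x := by
  refine ⟨(toMeasurable μ {x | ¬ p x})ᶜ, (measurableSet_toMeasurable _ _).compl, ?_, ?_⟩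
  · rw [ae_iff]
    simpa [measure_toMeasurable] using! h
  · intro x hx
    by_contra hp
    exact hx (subset_toMeasurable _ _ hp)

open Set in
-- Vertices with a neighbor outside the current set are discarded repeatedly. Each round costs only
-- a null set, since no set of positive measure is mapped along edges into a null set.
theorem IsPMPGraph.exists_closed_subset {X : Type*} [MeasurableSpace X] [StandardBorelSpace X]
    {G : SimpleGraph X} {μ : Measure X} [IsFiniteMeasure μ] (hpmp : IsPMPGraph G μ) {d : ℕ}
    {Y : Set X} (hY : MeasurableSet Y) (hYμ : ∀ᵐ x ∂μ, x ∈ Y) {nb : X → Fin d → X}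
    (hnb : Measurable nb) (hrange : ∀ x ∈ Y, range (nb x) = G.neighborSet x) :
    ∃ Z ⊆ Y, MeasurableSet Z ∧ (∀ᵐ x ∂μ, x ∈ Z) ∧ ∀ x ∈ Z, ∀ y, G.Adj x y → y ∈ Z := by
  have hnbi (i : Fin d) : Measurable fun x => nb x i := (measurable_pi_apply i).comp hnb
  let Z (n : ℕ) : Set X := Nat.rec Y (fun _ Z => Z ∩ ⋂ i, (fun x => nb x i) ⁻¹' Z) n
  have hZs (n : ℕ) : Z (n + 1) = Z n ∩ ⋂ i, (fun x => nb x i) ⁻¹' Z n := rfl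
  have hZY (n : ℕ) : Z n ⊆ Y := by
    induction n with
    | zero => exact subset_rfl
    | succ n ih => exact inter_subset_left.trans ih
  have hZ (n : ℕ) : MeasurableSet (Z n) ∧ ∀ᵐ x ∂μ, x ∈ Z n := by
    induction n with
    | zero => exact ⟨hY, hYμ⟩
    | succ n ih =>
      refine ⟨ih.1.inter (.iInter fun i => hnbi i ih.1), ?_⟩
      have : ∀ᵐ x ∂μ, ∀ i, nb x i ∈ Z n := by
        rw [ae_all_iff]
        intro i
        have h0 : μ (Y ∩ (fun x => nb x i) ⁻¹' (Z n)ᶜ) = 0 := by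
          refine hpmp.measure_eq_zero_of_mapsTo_null (hY.inter (hnbi i ih.1.compl)) (hnbi i)
            (fun x hx => ?_) (ae_iff.1 ih.2) fun x hx => hx.2
          have : nb x i ∈ G.neighborSet x := hrange x hx.1 ▸ mem_range_self i
          exact SimpleGraph.Adj.reachable this
        filter_upwards [hYμ, measure_eq_zero_iff_ae_notMem.1 h0] with x hx hx'
        by_contra hn
        exact hx' ⟨hx, hn⟩
      filter_upwards [ih.2, this] with x hx hx'
      exact ⟨hx, mem_iInter.2 hx'⟩
  refine ⟨⋂ n, Z n, (iInter_subset Z 0).trans (hZY 0), .iInter fun n => (hZ n).1, ?_, ?_⟩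
  · simp only [mem_iInter, ae_all_iff]
    exact fun n => (hZ n).2
  · intro x hx y hxy
    rw [mem_iInter] at hx ⊢
    intro n
    have hmem : y ∈ range (nb x) := hrange x (hZY 0 (hx 0)) ▸ hxy
    obtain ⟨i, rfl⟩ := hmem
    have h := hx (n + 1)
    rw [hZs] at h
    exact mem_iInter.1 h.2 i

/-- A Borel enumeration of the neighbors of each vertex in a conull Borel union of components. -/
structure NeighborEnumeration {X : Type*} [MeasurableSpace X] (G : SimpleGraph X) (μ : Measure X)
    (d : ℕ) where
  carrier : Set X
  measurableSet_carrier : MeasurableSet carrier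
  ae_mem : ∀ᵐ x ∂μ, x ∈ carrier
  mem_of_adj : ∀ x ∈ carrier, ∀ y, G.Adj x y → y ∈ carrier
  nb : Fin d → X → X
  measurable_nb : ∀ i, Measurable (nb i)
  injective_nb : ∀ x ∈ carrier, Function.Injective fun i => nb i x
  range_nb : ∀ x ∈ carrier, Set.range (fun i => nb i x) = G.neighborSet x

theorem IsRegularGraph.nonempty_neighborEnumeration {X : Type*} [MeasurableSpace X]
    [StandardBorelSpace X] {G : SimpleGraph X} {μ : Measure X} [IsFiniteMeasure μ] {d : ℕ}
    (hreg : IsRegularGraph G μ d) (hG : IsBorelGraph G) (hpmp : IsPMPGraph G μ) :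
    Nonempty (NeighborEnumeration G μ d) := by
  obtain ⟨Y, hY, hYμ, hd⟩ := exists_measurableSet_subset_conull hreg
  obtain ⟨nb, hnb, hnb'⟩ := hG.exists_measurable_enumeration hY hd
  obtain ⟨Z, hZY, hZ, hZμ, hZadj⟩ :=
    hpmp.exists_closed_subset hY hYμ hnb fun x hx => (hnb' x hx).2
  exact ⟨⟨Z, hZ, hZμ, hZadj, fun i x => nb x i, fun i => (measurable_pi_apply i).comp hnb,
    fun x hx => (hnb' x (hZY hx)).1, fun x hx => (hnb' x (hZY hx)).2⟩⟩

/-! ### The edge measure and its reversal invariance -/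

namespace NeighborEnumeration

variable {X : Type*} [MeasurableSpace X] {G : SimpleGraph X} {μ : Measure X} {d : ℕ}
  (E : NeighborEnumeration G μ d)

/-- Turns almost sure properties into properties of whole components, as ergodicity speaks of
exactly invariant sets. -/
theorem exists_closed_subset (E : NeighborEnumeration G μ d) [StandardBorelSpace X] [IsFiniteMeasure μ] (hpmp : IsPMPGraph G μ)
    {p : X → Prop} (h : ∀ᵐ x ∂μ, p x) :
    ∃ Z ⊆ E.carrier, MeasurableSet Z ∧ (∀ᵐ x ∂μ, x ∈ Z) ∧ (∀ x ∈ Z, ∀ y, G.Adj x y → y ∈ Z) ∧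
      ∀ x ∈ Z, p x := by
  obtain ⟨Y, hY, hYμ, hYp⟩ := exists_measurableSet_subset_conull h
  obtain ⟨Z, hZY, hZ⟩ := hpmp.exists_closed_subset (Y := E.carrier ∩ Y)
    (nb := fun x i => E.nb i x) (E.measurableSet_carrier.inter hY)
    (by filter_upwards [E.ae_mem, hYμ] with x h1 h2 using ⟨h1, h2⟩)
    (measurable_pi_lambda _ E.measurable_nb) fun x hx => E.range_nb x hx.1
  exact ⟨Z, fun x hx => (hZY hx).1, hZ.1, hZ.2.1, hZ.2.2, fun x hx => hYp x (hZY hx).2⟩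

theorem adj_nb {x : X} (hx : x ∈ E.carrier) (i : Fin d) : G.Adj x (E.nb i x) := by
  have : E.nb i x ∈ G.neighborSet x := E.range_nb x hx ▸ Set.mem_range_self i
  exact this

theorem exists_nb_eq {x y : X} (hx : x ∈ E.carrier) (h : G.Adj x y) : ∃ i, E.nb i x = y := by
  have : y ∈ Set.range fun i => E.nb i x := E.range_nb x hx ▸ h
  exact this

theorem nb_mem {x : X} (hx : x ∈ E.carrier) (i : Fin d) : E.nb i x ∈ E.carrier :=
  E.mem_of_adj x hx _ (E.adj_nb hx i)

theorem measurable_prodMk_nb (i : Fin d) : Measurable fun x => (x, E.nb i x) :=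
  measurable_id.prodMk (E.measurable_nb i)

/-- The measure on edges with marginals `d • μ`. -/
noncomputable def edgeMeasure : Measure (X × X) :=
  ∑ i, μ.map fun x => (x, E.nb i x)

theorem edgeMeasure_apply {S : Set (X × X)} (hS : MeasurableSet S) :
    E.edgeMeasure S = ∑ i, μ {x | (x, E.nb i x) ∈ S} := by
  simp only [edgeMeasure, Measure.coe_finsetSum, Finset.sum_apply]
  exact Finset.sum_congr rfl fun i _ => Measure.map_apply (E.measurable_prodMk_nb i) hS

theorem ae_edgeMeasure_iff {p : X × X → Prop} (hp : MeasurableSet {z | p z}) :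
    (∀ᵐ z ∂E.edgeMeasure, p z) ↔ ∀ᵐ x ∂μ, ∀ i, p (x, E.nb i x) := by
  rw [edgeMeasure, ae_finsetSum_measure_iff, ae_all_iff]
  simp only [Finset.mem_univ, true_imp_iff]
  exact forall_congr' fun i => ae_map_iff (E.measurable_prodMk_nb i).aemeasurable hp

instance [IsFiniteMeasure μ] : IsFiniteMeasure E.edgeMeasure := by
  unfold edgeMeasure
  infer_instance

/-- Exactly one index j leads back from the i-th neighbor. On each piece `E.nb i` is injective with
inverse `E.nb j`, so the pmp hypothesis applies there. -/
theorem measure_eq_sum [StandardBorelSpace X] {A : Set X} (hA : MeasurableSet A) (i : Fin d) :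
    μ A = ∑ j, μ {x | x ∈ A ∩ E.carrier ∧ E.nb j (E.nb i x) = x} := by
  have hA' : μ A = μ (⋃ j ∈ Finset.univ, {x | x ∈ A ∩ E.carrier ∧ E.nb j (E.nb i x) = x}) := by
    refine measure_congr ?_
    filter_upwards [E.ae_mem] with x hx
    refine propext ⟨fun h => ?_, fun h => ?_⟩
    · obtain ⟨j, hj⟩ := E.exists_nb_eq (E.nb_mem hx i) (E.adj_nb hx i).symm
      exact Set.mem_biUnion (Finset.mem_univ j) ⟨⟨h, hx⟩, hj⟩
    · obtain ⟨j, -, hj⟩ := Set.mem_iUnion₂.1 h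
      exact hj.1.1
  rw [hA', measure_biUnion_finset]
  · intro j _ l _ hjl
    rw [Function.onFun, Set.disjoint_left]
    intro x hx hx'
    exact hjl (E.injective_nb _ (E.nb_mem hx.1.2 i) (hx.2.trans hx'.2.symm))
  · intro j _
    exact (hA.inter E.measurableSet_carrier).inter
      (measurableSet_eq_fun ((E.measurable_nb j).comp (E.measurable_nb i)) measurable_id)

theorem map_swap_edgeMeasure [StandardBorelSpace X] (hpmp : IsPMPGraph G μ) :
    E.edgeMeasure.map Prod.swap = E.edgeMeasure := by
  ext S hS
  have hS' := measurable_swap hS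
  have hm (i : Fin d) : MeasurableSet {x | (x, E.nb i x) ∈ S} := E.measurable_prodMk_nb i hS
  have hm' (i : Fin d) : MeasurableSet {x | (E.nb i x, x) ∈ S} := E.measurable_prodMk_nb i hS'
  rw [Measure.map_apply measurable_swap hS, E.edgeMeasure_apply hS, E.edgeMeasure_apply hS']
  have h1 (i : Fin d) := E.measure_eq_sum (hm i) i
  have h2 (i : Fin d) := E.measure_eq_sum (hm' i) i
  simp only [Set.mem_preimage, Prod.swap_prod_mk, h1, h2]
  -- An edge with index i and return index j becomes, reversed, one with index j and return index i.
  rw [Finset.sum_comm]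
  refine Finset.sum_congr rfl fun j _ => Finset.sum_congr rfl fun i _ => ?_
  rw [← hpmp.measure_image_eq (k := E.nb i) _ (E.measurable_nb i)
    (fun x hx y hy hxy => by rw [← hx.2, ← hy.2, hxy])
    (fun x hx => (E.adj_nb hx.1.2 i).reachable)]
  · congr 1
    ext y
    constructor
    · rintro ⟨x, ⟨⟨hx, hxE⟩, hji⟩, rfl⟩
      exact ⟨⟨by simpa [hji] using hx, E.nb_mem hxE i⟩, by rw [hji]⟩
    · rintro ⟨⟨hy, hyE⟩, hij⟩
      exact ⟨E.nb j y, ⟨⟨by simpa [hij] using hy, E.nb_mem hyE j⟩, by rw [hij]⟩, hij⟩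
  · exact ((hm' i).inter E.measurableSet_carrier).inter
      (measurableSet_eq_fun ((E.measurable_nb j).comp (E.measurable_nb i)) measurable_id)

theorem map_fst_edgeMeasure : E.edgeMeasure.map Prod.fst = (d : ENNReal) • μ := by
  ext S hS
  rw [Measure.map_apply measurable_fst hS, E.edgeMeasure_apply (measurable_fst hS)]
  simp

theorem map_snd_edgeMeasure [StandardBorelSpace X] (hpmp : IsPMPGraph G μ) :
    E.edgeMeasure.map Prod.snd = (d : ENNReal) • μ := by
  rw [← E.map_fst_edgeMeasure, ← E.map_swap_edgeMeasure hpmp,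
    Measure.map_map measurable_snd measurable_swap, E.map_swap_edgeMeasure hpmp]
  rfl

/-- `E.nb i` need not be injective, but its image measure is one summand of the second marginal.
This domination makes composition with it bounded on L². -/
theorem map_nb_le [StandardBorelSpace X] (hpmp : IsPMPGraph G μ) (i : Fin d) :
    μ.map (E.nb i) ≤ (d : ENNReal) • μ := by
  rw [← E.map_snd_edgeMeasure hpmp]
  refine Measure.le_iff.2 fun S hS => ?_
  rw [Measure.map_apply (E.measurable_nb i) hS, Measure.map_apply measurable_snd hS,
    E.edgeMeasure_apply (measurable_snd hS)]
  exact Finset.single_le_sum (f := fun i => μ {x | (x, E.nb i x) ∈ Prod.snd ⁻¹' S})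
    (fun _ _ => zero_le) (Finset.mem_univ i)

theorem quasiMeasurePreserving_nb [StandardBorelSpace X] (hpmp : IsPMPGraph G μ) (i : Fin d) :
    Measure.QuasiMeasurePreserving (E.nb i) μ μ :=
  ⟨E.measurable_nb i, Measure.absolutelyContinuous_of_le_smul (E.map_nb_le hpmp i)⟩

variable {F : Type*} [NormedAddCommGroup F]

theorem memLp_comp_nb [StandardBorelSpace X] (hpmp : IsPMPGraph G μ) (i : Fin d) {f : X → F}
    {p : ENNReal} (hf : MemLp f p μ) : MemLp (fun x => f (E.nb i x)) p μ := by
  have h := hf.of_measure_le_smul (ENNReal.natCast_ne_top d) (E.map_nb_le hpmp i)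
  exact h.comp_of_map (E.measurable_nb i).aemeasurable

theorem memLp_comp_fst {f : X → F} {p : ENNReal} (hf : MemLp f p μ) :
    MemLp (fun z : X × X => f z.1) p E.edgeMeasure := by
  have h := hf.smul_measure (ENNReal.natCast_ne_top d)
  rw [← E.map_fst_edgeMeasure] at h
  exact h.comp_of_map measurable_fst.aemeasurable

theorem memLp_comp_snd [StandardBorelSpace X] (hpmp : IsPMPGraph G μ) {f : X → F} {p : ENNReal}
    (hf : MemLp f p μ) : MemLp (fun z : X × X => f z.2) p E.edgeMeasure := by
  have h := hf.smul_measure (ENNReal.natCast_ne_top d)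
  rw [← E.map_snd_edgeMeasure hpmp] at h
  exact h.comp_of_map measurable_snd.aemeasurable

variable [NormedSpace ℝ F]

theorem integral_comp_fst {f : X → F} (hf : AEStronglyMeasurable f μ) :
    ∫ z, f z.1 ∂E.edgeMeasure = (d : ℝ) • ∫ x, f x ∂μ := by
  have h := integral_map (μ := E.edgeMeasure) measurable_fst.aemeasurable
    (f := f) (by rw [E.map_fst_edgeMeasure]; exact hf.smul_measure _)
  rw [← h, E.map_fst_edgeMeasure, integral_smul_measure]
  simp

theorem integral_comp_snd [StandardBorelSpace X] (hpmp : IsPMPGraph G μ) {f : X → F}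
    (hf : AEStronglyMeasurable f μ) :
    ∫ z, f z.2 ∂E.edgeMeasure = (d : ℝ) • ∫ x, f x ∂μ := by
  have h := integral_map (μ := E.edgeMeasure) measurable_snd.aemeasurable
    (f := f) (by rw [E.map_snd_edgeMeasure hpmp]; exact hf.smul_measure _)
  rw [← h, E.map_snd_edgeMeasure hpmp, integral_smul_measure]
  simp

theorem integral_swap [StandardBorelSpace X] (hpmp : IsPMPGraph G μ) (Φ : X × X → F) :
    ∫ z, Φ z.swap ∂E.edgeMeasure = ∫ z, Φ z ∂E.edgeMeasure := by
  have h := integral_map_equiv (μ := E.edgeMeasure) MeasurableEquiv.prodComm Φ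
  rw [show (E.edgeMeasure.map MeasurableEquiv.prodComm) = E.edgeMeasure from
    E.map_swap_edgeMeasure hpmp] at h
  exact h.symm

theorem integral_edgeMeasure {Φ : X × X → F} (hΦ : Integrable Φ E.edgeMeasure) :
    ∫ z, Φ z ∂E.edgeMeasure = ∫ x, ∑ i, Φ (x, E.nb i x) ∂μ := by
  have hi := integrable_finsetSum_measure.1 hΦ
  have hi' (i : Fin d) : Integrable (fun x => Φ (x, E.nb i x)) μ :=
    (hi i (Finset.mem_univ i)).comp_measurable (E.measurable_prodMk_nb i)
  rw [edgeMeasure, integral_finsetSum_measure hi, integral_finsetSum _ fun i _ => hi' i]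
  exact Finset.sum_congr rfl fun i hi'' =>
    integral_map (E.measurable_prodMk_nb i).aemeasurable (hi i hi'').1

end NeighborEnumeration

/-! ### The adjacency operator and its quadratic form -/

theorem MeasureTheory.MemLp.integrable_inner_complex {α : Type*} [MeasurableSpace α]
    {ν : Measure α} {f g : α → ℂ} (hf : MemLp f 2 ν) (hg : MemLp g 2 ν) :
    Integrable (fun x => inner ℂ (f x) (g x)) ν := by
  refine (L2.integrable_inner (𝕜 := ℂ) (hf.toLp f) (hg.toLp g)).congr ?_
  filter_upwards [hf.coeFn_toLp, hg.coeFn_toLp] with x h1 h2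
  rw [h1, h2]

theorem MeasureTheory.L2.norm_sq_eq_integral {α : Type*} [MeasurableSpace α] {ν : Measure α}
    (f : Lp ℂ 2 ν) : ‖f‖ ^ 2 = ∫ x, ‖f x‖ ^ 2 ∂ν := by
  have h := inner_self_eq_norm_sq_to_K (𝕜 := ℂ) f
  rw [L2.inner_def] at h
  simp_rw [inner_self_eq_norm_sq_to_K, ← RCLike.ofReal_pow] at h
  rw [integral_ofReal] at h
  exact_mod_cast h.symm

namespace NeighborEnumeration

variable {X : Type*} [MeasurableSpace X] [StandardBorelSpace X] {G : SimpleGraph X}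
  {μ : Measure X} {d : ℕ} (E : NeighborEnumeration G μ d)

/-- Composition with `E.nb i` as an operator on `L²`. -/
noncomputable def compNb (hpmp : IsPMPGraph G μ) (i : Fin d) : Lp ℂ 2 μ →L[ℂ] Lp ℂ 2 μ :=
  LinearMap.mkContinuous
    { toFun f := (E.memLp_comp_nb hpmp i (Lp.memLp f)).toLp
      map_add' f g := by
        ext1
        refine (MemLp.coeFn_toLp _).trans (.trans ?_ (Lp.coeFn_add _ _).symm)
        filter_upwards [(E.memLp_comp_nb hpmp i (Lp.memLp f)).coeFn_toLp,
          (E.memLp_comp_nb hpmp i (Lp.memLp g)).coeFn_toLp,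
          (E.quasiMeasurePreserving_nb hpmp i).ae (Lp.coeFn_add f g)] with x h1 h2 h3
        rw [h3, Pi.add_apply, Pi.add_apply, h1, h2]
      map_smul' c f := by
        ext1
        refine (MemLp.coeFn_toLp _).trans (.trans ?_ (Lp.coeFn_smul _ _).symm)
        filter_upwards [(E.memLp_comp_nb hpmp i (Lp.memLp f)).coeFn_toLp,
          (E.quasiMeasurePreserving_nb hpmp i).ae (Lp.coeFn_smul c f)] with x h1 h3
        rw [h3, Pi.smul_apply, Pi.smul_apply, RingHom.id_apply, h1] }
    (((d : ENNReal) ^ (1 / (2 : ENNReal)).toReal).toReal) fun f => by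
      change ‖(E.memLp_comp_nb hpmp i (Lp.memLp f)).toLp‖ ≤ _
      rw [Lp.norm_toLp, Lp.norm_def, ← ENNReal.toReal_mul]
      refine ENNReal.toReal_mono (ENNReal.mul_ne_top (by simp) (Lp.eLpNorm_ne_top f)) ?_
      have h := eLpNorm_map_measure (μ := μ) (f := E.nb i) (g := f) (p := 2)
        ((Lp.aestronglyMeasurable f).mono_ac (E.quasiMeasurePreserving_nb hpmp i).2)
        (E.measurable_nb i).aemeasurable
      exact h.symm.trans_le (eLpNorm_le_of_measure_le_smul (E.map_nb_le hpmp i))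

theorem coeFn_compNb (hpmp : IsPMPGraph G μ) (i : Fin d) (f : Lp ℂ 2 μ) :
    E.compNb hpmp i f =ᵐ[μ] fun x => f (E.nb i x) :=
  (E.memLp_comp_nb hpmp i (Lp.memLp f)).coeFn_toLp

omit [StandardBorelSpace X] in
theorem finsum_neighborSet {M : Type*} [AddCommMonoid M] {x : X} (hx : x ∈ E.carrier)
    (f : X → M) : ∑ᶠ y ∈ G.neighborSet x, f y = ∑ i, f (E.nb i x) := by
  rw [← E.range_nb x hx, finsum_mem_range (E.injective_nb x hx), finsum_eq_sum_of_fintype]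

theorem isAdjacencyOperator_sum_compNb (hpmp : IsPMPGraph G μ) :
    IsAdjacencyOperator G μ (∑ i, E.compNb hpmp i) := by
  intro f
  have h : ∀ᵐ x ∂μ, ∀ i, E.compNb hpmp i f x = f (E.nb i x) :=
    ae_all_iff.2 fun i => E.coeFn_compNb hpmp i f
  rw [sum_apply]
  filter_upwards [Lp.coeFn_finsetSum Finset.univ fun i => E.compNb hpmp i f, h, E.ae_mem]
    with x h1 h2 h3
  rw [h1, E.finsum_neighborSet h3]
  simp [h2]

theorem isAdjacencyOperator (E : NeighborEnumeration G μ d) (hpmp : IsPMPGraph G μ) :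
    IsAdjacencyOperator G μ (adjacencyOperator G μ) := by
  have h : ∃ T, IsAdjacencyOperator G μ T := ⟨_, E.isAdjacencyOperator_sum_compNb hpmp⟩
  rw [adjacencyOperator, dif_pos h]
  exact h.choose_spec

theorem adjacencyOperator_apply (hpmp : IsPMPGraph G μ) (f : Lp ℂ 2 μ) :
    adjacencyOperator G μ f =ᵐ[μ] fun x => ∑ i, f (E.nb i x) := by
  filter_upwards [E.isAdjacencyOperator hpmp f, E.ae_mem] with x h1 h2
  rw [h1, E.finsum_neighborSet h2]

theorem integrable_inner (hpmp : IsPMPGraph G μ) (f g : Lp ℂ 2 μ) :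
    Integrable (fun z : X × X => inner ℂ (f z.1) (g z.2)) E.edgeMeasure :=
  (E.memLp_comp_fst (Lp.memLp f)).integrable_inner_complex (E.memLp_comp_snd hpmp (Lp.memLp g))

theorem inner_adjacencyOperator (hpmp : IsPMPGraph G μ) (f g : Lp ℂ 2 μ) :
    inner ℂ f (adjacencyOperator G μ g) =
      ∫ z : X × X, inner ℂ (f z.1) (g z.2) ∂E.edgeMeasure := by
  rw [L2.inner_def, E.integral_edgeMeasure (E.integrable_inner hpmp f g)]
  refine integral_congr_ae ?_
  filter_upwards [E.adjacencyOperator_apply hpmp g] with x hx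
  rw [hx, inner_sum]

theorem isSelfAdjoint_adjacencyOperator (E : NeighborEnumeration G μ d) (hpmp : IsPMPGraph G μ) :
    IsSelfAdjoint (adjacencyOperator G μ) := by
  rw [ContinuousLinearMap.isSelfAdjoint_iff_isSymmetric]
  intro f g
  change inner ℂ (adjacencyOperator G μ f) g = inner ℂ f (adjacencyOperator G μ g)
  rw [← inner_conj_symm, E.inner_adjacencyOperator hpmp, E.inner_adjacencyOperator hpmp,
    ← integral_conj, ← E.integral_swap hpmp]
  simp only [inner_conj_symm, Prod.fst_swap, Prod.snd_swap]

omit [StandardBorelSpace X] in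
theorem integral_norm_sq_fst (f : Lp ℂ 2 μ) :
    ∫ z : X × X, ‖f z.1‖ ^ 2 ∂E.edgeMeasure = d * ‖f‖ ^ 2 := by
  rw [L2.norm_sq_eq_integral, ← smul_eq_mul]
  exact E.integral_comp_fst ((Lp.aestronglyMeasurable f).norm.pow 2)

theorem integral_norm_sq_snd (hpmp : IsPMPGraph G μ) (f : Lp ℂ 2 μ) :
    ∫ z : X × X, ‖f z.2‖ ^ 2 ∂E.edgeMeasure = d * ‖f‖ ^ 2 := by
  rw [L2.norm_sq_eq_integral, ← smul_eq_mul]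
  exact E.integral_comp_snd hpmp ((Lp.aestronglyMeasurable f).norm.pow 2)

/-- The marginals give the two square terms and T the cross term. The sign s = 1 serves the bottom
of the spectrum, s = -1 the top. -/
theorem integral_norm_add_smul_sq (hpmp : IsPMPGraph G μ) (f : Lp ℂ 2 μ) {s : ℝ}
    (hs : s ^ 2 = 1) :
    ∫ z : X × X, ‖f z.1 + s * f z.2‖ ^ 2 ∂E.edgeMeasure =
      2 * (d * ‖f‖ ^ 2 + s * (inner ℂ f (adjacencyOperator G μ f)).re) := by
  have h1 := (E.memLp_comp_fst (Lp.memLp f)).norm.integrable_sq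
  have h2 := (E.memLp_comp_snd hpmp (Lp.memLp f)).norm.integrable_sq
  have h3 := ((E.integrable_inner hpmp f f).re).const_mul (2 * s)
  have hpt (z : X × X) : ‖f z.1 + s * f z.2‖ ^ 2 =
      ‖f z.1‖ ^ 2 + ‖f z.2‖ ^ 2 + 2 * s * RCLike.re (inner ℂ (f z.1) (f z.2)) := by
    rw [norm_add_sq (𝕜 := ℂ), norm_mul, mul_pow, Complex.norm_real, Real.norm_eq_abs, sq_abs, hs,
      ← smul_eq_mul (s : ℂ), inner_smul_right]
    simp
    ring
  simp_rw [hpt]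
  rw [integral_add (by exact h1.add h2) h3, integral_add h1 h2, integral_const_mul,
    E.integral_norm_sq_fst, E.integral_norm_sq_snd hpmp, integral_re (E.integrable_inner hpmp f f),
    ← E.inner_adjacencyOperator hpmp]
  simp
  ring

/-- On a conull union of components f is constant along edges, so preimages of Borel sets are
invariant, hence null or conull; countably many Borel sets separate the points of ℂ. -/
theorem ae_eq_const_of_ae_eq_nb (E : NeighborEnumeration G μ d) [IsProbabilityMeasure μ]
    (hpmp : IsPMPGraph G μ)
    (herg : IsErgodicGraph G μ) {f : X → ℂ} (hf : Measurable f)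
    (h : ∀ᵐ x ∂μ, ∀ i, f (E.nb i x) = f x) : ∃ c, ∀ᵐ x ∂μ, f x = c := by
  obtain ⟨Z, hZE, hZ, hZμ, hZadj, hZf⟩ := E.exists_closed_subset hpmp h
  have hZr {x y : X} (hxy : G.Reachable x y) (hx : x ∈ Z) : y ∈ Z ∧ f y = f x := by
    obtain ⟨w⟩ := hxy
    induction w with
    | nil => exact ⟨hx, rfl⟩
    | @cons u v w huv _ ih =>
      obtain ⟨i, hi⟩ := E.exists_nb_eq (hZE hx) huv
      obtain ⟨h1, h2⟩ := ih (hZadj _ hx _ huv)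
      exact ⟨h1, by rw [h2, ← hi, hZf _ hx i]⟩
  obtain ⟨c, hc⟩ := Filter.exists_eventuallyEq_const_of_forall_separating (l := ae μ) (f := f)
    MeasurableSet fun U hU => by
    have hinv : ∀ x y, G.Reachable x y → (x ∈ Z ∩ f ⁻¹' U ↔ y ∈ Z ∩ f ⁻¹' U) := by
      intro x y hxy
      constructor
      · rintro ⟨hx, hU⟩
        obtain ⟨h1, h2⟩ := hZr hxy hx
        exact ⟨h1, by rwa [Set.mem_preimage, h2]⟩
      · rintro ⟨hx, hU⟩
        obtain ⟨h1, h2⟩ := hZr hxy.symm hx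
        exact ⟨h1, by rwa [Set.mem_preimage, h2]⟩
    rcases herg _ (hZ.inter (hf hU)) hinv with h0 | h0
    · right
      filter_upwards [hZμ, measure_eq_zero_iff_ae_notMem.1 h0] with x h1 h2 h3
      exact h2 ⟨h1, h3⟩
    · left
      filter_upwards [measure_eq_zero_iff_ae_notMem.1 h0] with x h1
      exact (not_not.1 h1).2
  exact ⟨c, hc⟩

/-- The energy ∫ |f(x) - f(y)|² over edges vanishes for such f. -/
theorem ae_eq_const_of_adjacencyOperator_eq [IsProbabilityMeasure μ] (hpmp : IsPMPGraph G μ)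
    (herg : IsErgodicGraph G μ) {f : Lp ℂ 2 μ}
    (E : NeighborEnumeration G μ d)
    (hf : adjacencyOperator G μ f = (d : ℂ) • f) : ∃ c, ∀ᵐ x ∂μ, f x = c := by
  have h0 : ∫ z : X × X, ‖f z.1 + (-1 : ℝ) * f z.2‖ ^ 2 ∂E.edgeMeasure = 0 := by
    rw [E.integral_norm_add_smul_sq hpmp f (by norm_num), hf, inner_smul_right,
      inner_self_eq_norm_sq_to_K]
    simp only [Complex.coe_algebraMap, Complex.mul_re, Complex.natCast_re,
      Complex.natCast_im, zero_mul, sub_zero, ← Complex.ofReal_pow, Complex.ofReal_re]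
    ring
  have hm := (Lp.stronglyMeasurable f).measurable
  have hint : Integrable (fun z : X × X => ‖f z.1 + (-1 : ℝ) * f z.2‖ ^ 2) E.edgeMeasure :=
    ((E.memLp_comp_fst (Lp.memLp f)).add
      ((E.memLp_comp_snd hpmp (Lp.memLp f)).const_mul _)).norm.integrable_sq
  rw [integral_eq_zero_iff_of_nonneg (fun z => by positivity) hint] at h0
  have h1 : ∀ᵐ z ∂E.edgeMeasure, f z.2 = f z.1 := by
    filter_upwards [h0] with z hz
    replace hz := norm_eq_zero.1 (pow_eq_zero_iff two_ne_zero |>.1 hz)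
    push_cast at hz
    linear_combination -hz
  rw [E.ae_edgeMeasure_iff (p := fun z => f z.2 = f z.1)
    (measurableSet_eq_fun (hm.comp measurable_snd) (hm.comp measurable_fst))] at h1
  exact E.ae_eq_const_of_ae_eq_nb hpmp herg hm h1

end NeighborEnumeration

/-! ### Self-adjoint operators: invertibility and spectral gap -/

section Hilbert

variable {H : Type*} [NormedAddCommGroup H] [InnerProductSpace ℂ H] [CompleteSpace H]

/-- S² is coercive because ⟨S²f, f⟩ = ‖Sf‖², and S is invertible when S² is. -/
theorem IsSelfAdjoint.isUnit_of_bounded_below {S : H →L[ℂ] H} (hS : IsSelfAdjoint S) {c : ℝ}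
    (hc : 0 < c) (h : ∀ f, c * ‖f‖ ≤ ‖S f‖) : IsUnit S := by
  refine (isUnit_pow_iff two_ne_zero).1 ?_
  refine ContinuousLinearMap.isUnit_of_forall_le_norm_inner_map _
    (c := ⟨c ^ 2, by positivity⟩) (by exact pow_pos hc 2) fun f => ?_
  have hsym := (ContinuousLinearMap.isSelfAdjoint_iff_isSymmetric.1 hS) (S f) f
  have h1 : inner ℂ ((S ^ 2) f) f = inner ℂ (S f) (S f) := by
    rw [pow_two]; exact hsym
  have h2 : ‖inner ℂ (S f) (S f)‖ = ‖S f‖ ^ 2 := by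
    rw [inner_self_eq_norm_sq_to_K]; simp
  rw [h1, h2]
  change ‖f‖ ^ 2 * c ^ 2 ≤ _
  rw [← mul_pow, mul_comm]
  exact pow_le_pow_left₀ (by positivity) (h f) 2

/-- The spectral projection of an isolated maximal spectral value. -/
theorem IsSelfAdjoint.exists_projection_of_gap {T : H →L[ℂ] H} (hT : IsSelfAdjoint T) {D ε : ℝ}
    (hε : 0 < ε) (hσ : ∀ x ∈ spectrum ℝ T, x ≤ D - ε ∨ x = D) :
    ∃ P : H →L[ℂ] H, IsSelfAdjoint P ∧ P * P = P ∧ T * P = D • P ∧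
      ∀ h, (inner ℂ h (T h)).re ≤ (D - ε) * ‖h‖ ^ 2 + ε * (inner ℂ h (P h)).re := by
  -- A continuous function which on the spectrum is the indicator of D; the gap leaves room for the
  -- linear ramp.
  let φ : ℝ → ℝ := fun x => max 0 ((x - (D - ε)) / ε)
  have hφ : Continuous φ := by fun_prop
  have hφx {x : ℝ} (hx : x ∈ spectrum ℝ T) : (x ≤ D - ε ∧ φ x = 0) ∨ (x = D ∧ φ x = 1) := by
    rcases hσ x hx with h | rfl
    · left
      exact ⟨h, max_eq_left (div_nonpos_of_nonpos_of_nonneg (by linarith) hε.le)⟩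
    · right
      refine ⟨rfl, ?_⟩
      have : (x - (x - ε)) / ε = 1 := by field_simp; ring
      simp only [φ, this]
      norm_num
  have hPP : cfc φ T * cfc φ T = cfc φ T := by
    rw [← cfc_mul φ φ T hφ.continuousOn hφ.continuousOn]
    refine cfc_congr fun x hx => ?_
    rcases hφx hx with h | h <;> simp [h.2]
  have hTP : T * cfc φ T = D • cfc φ T := by
    nth_rw 1 [← cfc_id' ℝ T]
    rw [← cfc_mul (fun x => x) φ T continuousOn_id hφ.continuousOn,
      ← cfc_const_mul D φ T hφ.continuousOn]
    refine cfc_congr fun x hx => ?_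
    rcases hφx hx with h | h
    · simp [h.2]
    · simp [h.1]
  refine ⟨cfc φ T, cfc_predicate φ T, hPP, hTP, fun h => ?_⟩
  -- On the spectrum x ≤ (D - ε) + ε φ(x), with equality at D.
  have hpos : 0 ≤ cfc (fun x => ((D - ε) - x) + ε * φ x) T := by
    refine cfc_nonneg fun x hx => ?_
    rcases hφx hx with h | h <;> rw [h.2]
    · linarith [h.1]
    · rw [h.1]; linarith
  rw [cfc_add T (fun x => (D - ε) - x) (fun x => ε * φ x) (by fun_prop) (by fun_prop),
    cfc_const_mul ε φ T hφ.continuousOn, cfc_sub (fun _ => D - ε) (fun x => x) T (by fun_prop)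
    (by fun_prop), cfc_const _ T, cfc_id' ℝ T, ContinuousLinearMap.nonneg_iff_isPositive] at hpos
  have := hpos.re_inner_nonneg_right h
  rw [Algebra.algebraMap_eq_smul_one] at this
  simp only [add_apply, sub_apply, smul_apply, one_apply_eq_self,
    inner_add_right, inner_sub_right, inner_smul_right_eq_smul] at this
  simp [← Complex.ofReal_pow] at this
  linarith

end Hilbert

/-! ### From the spectral value -d to an approximate bipartition -/

namespace NeighborEnumeration

variable {X : Type*} [MeasurableSpace X] [StandardBorelSpace X] {G : SimpleGraph X}
  {μ : Measure X} {d : ℕ} (E : NeighborEnumeration G μ d)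

/-- The spectral projection at d maps h to a constant, whose norm is at most |∫ h|; off this part of
h the form of d - T is at least ε. -/
theorem poincare_of_gap [IsProbabilityMeasure μ] (hpmp : IsPMPGraph G μ)
    (herg : IsErgodicGraph G μ) {ε : ℝ} (hε : 0 < ε)
    (hσ : ∀ x ∈ spectrum ℝ (adjacencyOperator G μ), x ≤ d - ε ∨ x = d) (h : Lp ℂ 2 μ) :
    2 * ε * (‖h‖ ^ 2 - ‖∫ x, h x ∂μ‖ ^ 2) ≤
      ∫ z : X × X, ‖h z.1 - h z.2‖ ^ 2 ∂E.edgeMeasure := by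
  obtain ⟨P, hP, hPP, hTP, hle⟩ :=
    (E.isSelfAdjoint_adjacencyOperator hpmp).exists_projection_of_gap hε hσ
  have hTPh : adjacencyOperator G μ (P h) = (d : ℂ) • P h := by
    have := congrArg (fun S : Lp ℂ 2 μ →L[ℂ] Lp ℂ 2 μ => S h) hTP
    simp only [mul_apply_eq_comp] at this
    rw [this]
    ext1
    refine (Lp.coeFn_smul _ _).trans (.trans ?_ (Lp.coeFn_smul _ _).symm)
    filter_upwards with x
    simp
  obtain ⟨c, hc⟩ := ae_eq_const_of_adjacencyOperator_eq hpmp herg E hTPh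
  have hn : ‖P h‖ ^ 2 = ‖c‖ ^ 2 := by
    rw [L2.norm_sq_eq_integral, integral_congr_ae (g := fun _ => ‖c‖ ^ 2)]
    · simp
    · filter_upwards [hc] with x hx
      rw [hx]
  have hin : inner ℂ h (P h) = c * (starRingEnd ℂ) (∫ x, h x ∂μ) := by
    rw [L2.inner_def, ← integral_conj, ← integral_const_mul]
    refine integral_congr_ae ?_
    filter_upwards [hc] with x hx
    rw [hx]
    simp
  have hnin : (inner ℂ h (P h)).re = ‖P h‖ ^ 2 := by
    have h1 : inner ℂ (P h) (P h) = inner ℂ h (P h) := by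
      have := (ContinuousLinearMap.isSelfAdjoint_iff_isSymmetric.1 hP) h (P h)
      refine this.trans ?_
      change inner ℂ h ((P * P) h) = _
      rw [hPP]
    rw [← h1, inner_self_eq_norm_sq_to_K]
    norm_cast
  -- Since P is a projection, |c|² = ‖Ph‖² = ⟨h, Ph⟩, which is c times the conjugate of ∫ h.
  have hb : ‖c‖ ^ 2 ≤ ‖c‖ * ‖∫ x, h x ∂μ‖ := by
    rw [← hn, ← hnin, hin]
    refine (Complex.re_le_norm _).trans ?_
    rw [norm_mul, RCLike.norm_conj]
  have hb' : ‖c‖ ≤ ‖∫ x, h x ∂μ‖ := by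
    rcases (norm_nonneg c).eq_or_lt with h0 | h0
    · rw [← h0]; positivity
    · rw [pow_two] at hb
      exact le_of_mul_le_mul_left hb h0
  have hb2 : ‖c‖ ^ 2 ≤ ‖∫ x, h x ∂μ‖ ^ 2 := pow_le_pow_left₀ (norm_nonneg c) hb' 2
  have hen := E.integral_norm_add_smul_sq hpmp h (s := -1) (by norm_num)
  have heq (z : X × X) : ‖h z.1 + ((-1 : ℝ) : ℂ) * h z.2‖ ^ 2 = ‖h z.1 - h z.2‖ ^ 2 := by
    congr 2; push_cast; ring
  simp_rw [heq] at hen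
  rw [hen]
  have := hle h
  rw [hnin, hn] at this
  nlinarith

/-- If `-d` is a spectral value, some real function almost changes sign along every edge. -/
theorem exists_real_of_neg_mem_spectrum (hpmp : IsPMPGraph G μ)
    (hd : -(d : ℂ) ∈ spectrum ℂ (adjacencyOperator G μ)) {δ : ℝ} (hδ : 0 < δ) :
    ∃ r : X → ℝ, Measurable r ∧ MemLp r 2 μ ∧
      ∫ z : X × X, (r z.1 + r z.2) ^ 2 ∂E.edgeMeasure < δ * ∫ x, r x ^ 2 ∂μ := by
  -- Otherwise the reverse inequality, applied to real and imaginary parts, makes T + d coercive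
  -- with constant δ / 2.
  by_contra! hcon
  rw [spectrum.mem_iff] at hd
  refine hd ?_
  have hunit : IsUnit (adjacencyOperator G μ + (d : ℂ) • 1) := by
    refine ContinuousLinearMap.isUnit_of_forall_le_norm_inner_map _
      (c := ⟨δ / 2, by positivity⟩) (by exact half_pos hδ) fun f => ?_
    have hf := Lp.memLp f
    have hfm := (Lp.stronglyMeasurable f).measurable
    have h1 := hcon (fun x => (f x).re) (Complex.measurable_re.comp hfm) hf.re
    have h2 := hcon (fun x => (f x).im) (Complex.measurable_im.comp hfm) hf.im
    have hsum := E.integral_norm_add_smul_sq hpmp f (s := 1) (by norm_num)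
    have hpt (a : ℂ) : ‖a‖ ^ 2 = a.re ^ 2 + a.im ^ 2 := by
      rw [← Complex.normSq_eq_norm_sq, Complex.normSq_apply]; ring
    have heq (z : X × X) : ‖f z.1 + ((1 : ℝ) : ℂ) * f z.2‖ ^ 2 =
        ((f z.1).re + (f z.2).re) ^ 2 + ((f z.1).im + (f z.2).im) ^ 2 := by
      rw [hpt]; simp
    have i1 : Integrable (fun z : X × X => ((f z.1).re + (f z.2).re) ^ 2) E.edgeMeasure :=
      ((E.memLp_comp_fst hf).re.add (E.memLp_comp_snd hpmp hf).re).integrable_sq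
    have i2 : Integrable (fun z : X × X => ((f z.1).im + (f z.2).im) ^ 2) E.edgeMeasure :=
      ((E.memLp_comp_fst hf).im.add (E.memLp_comp_snd hpmp hf).im).integrable_sq
    simp_rw [heq] at hsum
    rw [integral_add i1 i2] at hsum
    have hns : ‖f‖ ^ 2 = ∫ x, (f x).re ^ 2 ∂μ + ∫ x, (f x).im ^ 2 ∂μ := by
      rw [L2.norm_sq_eq_integral, integral_congr_ae (.of_forall fun x => hpt (f x))]
      exact integral_add hf.re.integrable_sq hf.im.integrable_sq
    have hre : (inner ℂ f ((adjacencyOperator G μ + (d : ℂ) • 1) f)).re =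
        d * ‖f‖ ^ 2 + (inner ℂ f (adjacencyOperator G μ f)).re := by
      have : (adjacencyOperator G μ + (d : ℂ) • (1 : Lp ℂ 2 μ →L[ℂ] Lp ℂ 2 μ)) f =
        adjacencyOperator G μ f + (d : ℂ) • f := rfl
      rw [this, inner_add_right, inner_smul_right, inner_self_eq_norm_sq_to_K, Complex.add_re]
      simp [← Complex.ofReal_pow]
      ring
    rw [← inner_conj_symm, RCLike.norm_conj]
    refine le_trans ?_ (Complex.re_le_norm _)
    rw [hre]
    change ‖f‖ ^ 2 * (δ / 2) ≤ _
    nlinarith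
  have heq : algebraMap ℂ (Lp ℂ 2 μ →L[ℂ] Lp ℂ 2 μ) (-(d : ℂ)) - adjacencyOperator G μ =
      -(adjacencyOperator G μ + (d : ℂ) • 1) := by
    rw [Algebra.algebraMap_eq_smul_one, neg_smul]
    abel
  rw [heq]
  exact hunit.neg

end NeighborEnumeration

namespace NeighborEnumeration

variable {X : Type*} [MeasurableSpace X] [StandardBorelSpace X] {G : SimpleGraph X}
  {μ : Measure X} {d : ℕ} (E : NeighborEnumeration G μ d)

theorem poincare_of_gap_real [IsProbabilityMeasure μ] (hpmp : IsPMPGraph G μ)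
    (herg : IsErgodicGraph G μ) {ε : ℝ} (hε : 0 < ε)
    (hσ : ∀ x ∈ spectrum ℝ (adjacencyOperator G μ), x ≤ d - ε ∨ x = d) {a : X → ℝ}
    (ham : Measurable a) (ha : MemLp a 2 μ) :
    2 * ε * (∫ x, a x ^ 2 ∂μ - (∫ x, a x ∂μ) ^ 2) ≤
      ∫ z : X × X, (a z.1 - a z.2) ^ 2 ∂E.edgeMeasure := by
  have ha' : MemLp (fun x => (a x : ℂ)) 2 μ := ha.ofReal
  have h := E.poincare_of_gap hpmp herg hε hσ ha'.toLp
  have hae := ha'.coeFn_toLp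
  set f := ha'.toLp
  have hn : ‖f‖ ^ 2 = ∫ x, a x ^ 2 ∂μ := by
    rw [L2.norm_sq_eq_integral]
    refine integral_congr_ae ?_
    filter_upwards [hae] with x hx
    rw [hx]
    simp
  have hi : ∫ x, f x ∂μ = ((∫ x, a x ∂μ : ℝ) : ℂ) := by
    rw [integral_congr_ae hae]
    exact integral_ofReal
  have hE : ∫ z : X × X, ‖f z.1 - f z.2‖ ^ 2 ∂E.edgeMeasure =
      ∫ z : X × X, (a z.1 - a z.2) ^ 2 ∂E.edgeMeasure := by
    have h1 : ∀ᵐ z ∂E.edgeMeasure, f z.1 = a z.1 ∧ f z.2 = a z.2 := by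
      have hfm := (Lp.stronglyMeasurable f).measurable
      have hac : Measurable fun x => (a x : ℂ) := Complex.measurable_ofReal.comp ham
      rw [E.ae_edgeMeasure_iff (p := fun z => f z.1 = a z.1 ∧ f z.2 = a z.2)
        ((measurableSet_eq_fun (hfm.comp measurable_fst) (hac.comp measurable_fst)).inter
        (measurableSet_eq_fun (hfm.comp measurable_snd) (hac.comp measurable_snd)))]
      have := ae_all_iff.2 fun i => (E.quasiMeasurePreserving_nb hpmp i).ae hae
      filter_upwards [hae, this] with x h2 h3 i
      exact ⟨h2, h3 i⟩
    refine integral_congr_ae ?_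
    filter_upwards [h1] with z hz
    rw [hz.1, hz.2, ← Complex.ofReal_sub, Complex.norm_real, Real.norm_eq_abs, sq_abs]
  rw [hn, hi, Complex.norm_real, Real.norm_eq_abs, sq_abs, hE] at h
  exact h

omit [StandardBorelSpace X] in
theorem measureReal_exists_nb_le (E : NeighborEnumeration G μ d) [IsFiniteMeasure μ]
    {S : Set (X × X)} (hS : MeasurableSet S) :
    μ.real {x | ∃ i, (x, E.nb i x) ∈ S} ≤ E.edgeMeasure.real S := by
  refine ENNReal.toReal_mono (measure_ne_top _ _) ?_
  rw [E.edgeMeasure_apply hS, Set.ofPred_exists]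
  refine (measure_iUnion_le _).trans ?_
  rw [tsum_fintype]

theorem isApproxMeasurablyBipartite_of_gap (E : NeighborEnumeration G μ d)
    [IsProbabilityMeasure μ] (hpmp : IsPMPGraph G μ)
    (herg : IsErgodicGraph G μ) {ε : ℝ} (hε : 0 < ε)
    (hσ : ∀ x ∈ spectrum ℝ (adjacencyOperator G μ), x ≤ d - ε ∨ x = d)
    (hd : -(d : ℂ) ∈ spectrum ℂ (adjacencyOperator G μ)) : IsApproxMeasurablyBipartite G μ := by
  intro η hη
  -- The bound ε / 2 keeps the mean m of |r| at least 3/4. The term 8δ/ε is the Chebyshev bound for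
  -- ||r| - m| ≥ 1/4, and δ bounds the vertices with an edge where |r(x) + r(y)| ≥ 1.
  obtain ⟨δ, hδ, hδε, hδη⟩ : ∃ δ > 0, δ ≤ ε / 2 ∧ 8 * δ / ε + δ < η := by
    refine ⟨min (ε / 2) (η / (2 * (8 / ε + 1))), by positivity, min_le_left _ _, ?_⟩
    have h1 : min (ε / 2) (η / (2 * (8 / ε + 1))) * (2 * (8 / ε + 1)) ≤ η := by
      rw [← le_div_iff₀ (by positivity)]
      exact min_le_right _ _
    set δ := min (ε / 2) (η / (2 * (8 / ε + 1)))
    have h2 : 8 * δ / ε + δ = δ * (2 * (8 / ε + 1)) / 2 := by ring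
    rw [h2]
    linarith
  obtain ⟨q, hqm, hq, hqlt⟩ := E.exists_real_of_neg_mem_spectrum hpmp hd hδ
  have hq0 : 0 ≤ ∫ z : X × X, (q z.1 + q z.2) ^ 2 ∂E.edgeMeasure :=
    integral_nonneg fun z => sq_nonneg _
  have hpos : 0 < ∫ x, q x ^ 2 ∂μ := pos_of_mul_pos_right (hq0.trans_lt hqlt) hδ.le
  set s := ∫ x, q x ^ 2 ∂μ
  obtain ⟨r, hrm, hr, hr1, hrlt⟩ : ∃ r : X → ℝ, Measurable r ∧ MemLp r 2 μ ∧
      ∫ x, r x ^ 2 ∂μ = 1 ∧ ∫ z : X × X, (r z.1 + r z.2) ^ 2 ∂E.edgeMeasure < δ := by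
    have hss : ((√s)⁻¹) ^ 2 = s⁻¹ := by rw [inv_pow, Real.sq_sqrt hpos.le]
    refine ⟨fun x => (√s)⁻¹ * q x, hqm.const_mul _, hq.const_mul _, ?_, ?_⟩
    · simp_rw [mul_pow, hss]
      rw [integral_const_mul]
      exact inv_mul_cancel₀ hpos.ne'
    · simp_rw [← mul_add, mul_pow, hss]
      rw [integral_const_mul, inv_mul_lt_iff₀ hpos, mul_comm s]
      exact hqlt
  have habs := E.poincare_of_gap_real hpmp herg hε hσ (hrm.abs) hr.abs
  have hle : ∫ z : X × X, (|r z.1| - |r z.2|) ^ 2 ∂E.edgeMeasure ≤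
      ∫ z : X × X, (r z.1 + r z.2) ^ 2 ∂E.edgeMeasure := by
    refine integral_mono ((E.memLp_comp_fst hr.abs).sub
      (E.memLp_comp_snd hpmp hr.abs)).integrable_sq
      ((E.memLp_comp_fst hr).add (E.memLp_comp_snd hpmp hr)).integrable_sq fun z => ?_
    rw [← sq_abs (|r z.1| - |r z.2|), ← sq_abs (r z.1 + r z.2)]
    have := abs_abs_sub_abs_le (r z.1) (-r z.2)
    rw [abs_neg, sub_neg_eq_add] at this
    exact pow_le_pow_left₀ (abs_nonneg _) this 2
  simp only [sq_abs, hr1] at habs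
  set m := ∫ x, |r x| ∂μ with hm
  have hm0 : 0 ≤ m := integral_nonneg fun x => abs_nonneg _
  have hvar : 2 * ε * (1 - m ^ 2) < δ := habs.trans_lt (hle.trans_lt hrlt)
  have hm34 : 3 / 4 ≤ m := by
    by_contra! hlt
    have : m ^ 2 ≤ 9 / 16 := by nlinarith
    nlinarith
  have hri : Integrable (fun x => |r x|) μ := hr.abs.integrable (by norm_num)
  have hbad1 : μ.real {x | 1 / 16 ≤ (|r x| - m) ^ 2} ≤ 8 * δ / ε := by
    have hint : ∫ x, (|r x| - m) ^ 2 ∂μ = 1 - m ^ 2 := by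
      have hpt (x : X) : (|r x| - m) ^ 2 = r x ^ 2 - 2 * m * |r x| + m ^ 2 := by
        rw [sub_sq, sq_abs]; ring
      simp_rw [hpt]
      rw [integral_add (by exact hr.integrable_sq.sub (hri.const_mul _)) (integrable_const _),
        integral_sub hr.integrable_sq (hri.const_mul _), integral_const_mul, hr1, ← hm]
      simp
      ring
    have := mul_meas_ge_le_integral_of_nonneg (μ := μ) (f := fun x => (|r x| - m) ^ 2)
      (.of_forall fun x => sq_nonneg _) (hr.abs.sub (memLp_const m)).integrable_sq (1 / 16)
    rw [hint] at this
    rw [le_div_iff₀ hε]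
    nlinarith
  let S : Set (X × X) := {z | 1 ≤ (r z.1 + r z.2) ^ 2}
  have hS : MeasurableSet S := measurableSet_le measurable_const
    (((hrm.comp measurable_fst).add (hrm.comp measurable_snd)).pow_const 2)
  have hbad2 : μ.real {x | ∃ i, (x, E.nb i x) ∈ S} ≤ δ := by
    refine (E.measureReal_exists_nb_le hS).trans (le_trans ?_ hrlt.le)
    have := mul_meas_ge_le_integral_of_nonneg (μ := E.edgeMeasure)
      (f := fun z : X × X => (r z.1 + r z.2) ^ 2) (.of_forall fun x => sq_nonneg _)
      ((E.memLp_comp_fst hr).add (E.memLp_comp_snd hpmp hr)).integrable_sq 1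
    rwa [one_mul] at this
  set B1 : Set X := {x | 1 / 16 ≤ (|r x| - m) ^ 2}
  set B2 : Set X := {x | ∃ i, (x, E.nb i x) ∈ S}
  have hB2 : MeasurableSet B2 := by
    have : B2 = ⋃ i, (fun x => (x, E.nb i x)) ⁻¹' S := by ext; simp [B2]
    rw [this]
    exact .iUnion fun i => E.measurable_prodMk_nb i hS
  -- Adjacent vertices both with r > 1/2, or both with r < -1/2, would have |r(x) + r(y)| > 1, which
  -- is excluded off `B2`. Off `B1`, |r| > 1/2.
  let A : Set X := (E.carrier \ B2) ∩ {x | 1 / 2 < r x}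
  let B : Set X := (E.carrier \ B2) ∩ {x | r x < -(1 / 2)}
  have hA : MeasurableSet A := (E.measurableSet_carrier.diff hB2).inter
    (measurableSet_lt measurable_const hrm)
  have hB : MeasurableSet B := (E.measurableSet_carrier.diff hB2).inter
    (measurableSet_lt hrm measurable_const)
  refine ⟨A, B, hA.nullMeasurableSet, hB.nullMeasurableSet, ?_, ?_, ?_, ?_⟩
  · rw [Set.disjoint_left]
    rintro x ⟨-, hx⟩ ⟨-, hx'⟩
    simp only [Set.mem_ofPred_eq] at hx hx'
    linarith
  · rintro x ⟨⟨hxE, hx2⟩, hx⟩ y ⟨-, hy⟩ - hxy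
    obtain ⟨i, rfl⟩ := E.exists_nb_eq hxE hxy
    simp only [Set.mem_ofPred_eq] at hx hy
    refine hx2 ⟨i, ?_⟩
    change 1 ≤ (r x + r (E.nb i x)) ^ 2
    nlinarith
  · rintro x ⟨⟨hxE, hx2⟩, hx⟩ y ⟨-, hy⟩ - hxy
    obtain ⟨i, rfl⟩ := E.exists_nb_eq hxE hxy
    simp only [Set.mem_ofPred_eq] at hx hy
    refine hx2 ⟨i, ?_⟩
    change 1 ≤ (r x + r (E.nb i x)) ^ 2
    nlinarith
  · have hcompl : μ.real (A ∪ B)ᶜ ≤ μ.real (B1 ∪ B2) := by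
      refine ENNReal.toReal_mono (measure_ne_top _ _) (measure_mono_ae ?_)
      filter_upwards [E.ae_mem] with x hxE hx
      by_contra hcon
      have hcon' : x ∉ B1 ∪ B2 := hcon
      rw [Set.mem_union, not_or] at hcon'
      obtain ⟨h1, h2⟩ := hcon'
      replace h1 : (|r x| - m) ^ 2 < 1 / 16 := not_le.1 h1
      have h3 : 1 / 2 < |r x| := by nlinarith
      rcases lt_abs.1 h3 with h | h
      · exact hx (Or.inl ⟨⟨hxE, h2⟩, h⟩)
      · exact hx (Or.inr ⟨⟨hxE, h2⟩, by simp only [Set.mem_ofPred_eq]; linarith⟩)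
    have hu := measureReal_union_le (μ := μ) B1 B2
    rw [probReal_compl_eq_one_sub (hA.union hB)] at hcompl
    linarith

end NeighborEnumeration

/-! ### From an approximate bipartition to a symmetric spectrum -/

namespace NeighborEnumeration

variable {X : Type*} [MeasurableSpace X] [StandardBorelSpace X] {G : SimpleGraph X}
  {μ : Measure X} {d : ℕ} (E : NeighborEnumeration G μ d)

theorem measure_preimage_nb_le (hpmp : IsPMPGraph G μ) (i : Fin d) {S : Set X}
    (hS : MeasurableSet S) : μ (E.nb i ⁻¹' S) ≤ d * μ S := by
  rw [← Measure.map_apply (E.measurable_nb i) hS]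
  simpa using E.map_nb_le hpmp i S

open Set in
/-- Multiplication by the sign function of an approximate bipartition almost anticommutes with the
adjacency operator. -/
theorem exists_sign (E : NeighborEnumeration G μ d) [IsProbabilityMeasure μ]
    (hpmp : IsPMPGraph G μ)
    (hbip : IsApproxMeasurablyBipartite G μ) (f : Lp ℂ 2 μ) {κ : ℝ} (hκ : 0 < κ) :
    ∃ u : X → ℂ, AEStronglyMeasurable u μ ∧ (∀ x, ‖u x‖ ≤ 1) ∧
      ∀ g v : Lp ℂ 2 μ, (∀ᵐ x ∂μ, g x = u x * f x) →
        (∀ᵐ x ∂μ, v x = u x * adjacencyOperator G μ f x) →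
        ‖adjacencyOperator G μ g + v‖ ≤ κ ∧ ‖f‖ ≤ ‖g‖ + κ := by
  -- Dominates T(uf) + u Tf pointwise, as |u(x) + u(y)| ≤ 2. Its L² norm over sets of small measure
  -- is small.
  let F : X → ℝ := fun x => 2 * ∑ i, ‖f (E.nb i x)‖
  have hF : MemLp F 2 μ :=
    (memLp_finsetSum _ fun i _ => (E.memLp_comp_nb hpmp i (Lp.memLp f)).norm).const_mul 2
  obtain ⟨δ₁, hδ₁, h₁⟩ := hF.eLpNorm_indicator_le (by norm_num) (by norm_num) hκ
  obtain ⟨δ₂, hδ₂, h₂⟩ := (Lp.memLp f).eLpNorm_indicator_le (by norm_num) (by norm_num) hκ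
  -- The error lives on uncolored vertices and those with an uncolored neighbor: each of the d
  -- neighbor maps multiplies measure by at most d, giving the factor 1 + d².
  obtain ⟨A, B, hA, hB, hAB, hAi, hBi, hlt⟩ := hbip (min (δ₁ / (1 + d * d)) δ₂)
    (lt_min (by positivity) hδ₂)
  set S := toMeasurable μ (A ∪ B)ᶜ with hSdef
  have hS : MeasurableSet S := measurableSet_toMeasurable _ _
  have hμS : μ.real S < min (δ₁ / (1 + d * d)) δ₂ := by
    rw [measureReal_def, measure_toMeasurable, ← measureReal_def,
      probReal_compl_eq_one_sub₀ (hA.union hB)]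
    linarith
  have hnS {x : X} (hx : x ∉ S) : x ∈ A ∪ B := by
    by_contra h
    exact hx (subset_toMeasurable _ _ h)
  let S' : Set X := S ∪ ⋃ i, E.nb i ⁻¹' S
  have hS' : MeasurableSet S' := hS.union (.iUnion fun i => E.measurable_nb i hS)
  have hμS' : μ S' ≤ ENNReal.ofReal δ₁ := by
    have hle : μ S' ≤ (1 + d * d) * μ S := by
      refine (measure_union_le _ _).trans ?_
      rw [add_mul, one_mul]
      gcongr
      refine (measure_iUnion_le _).trans ?_
      rw [tsum_fintype]
      refine (Finset.sum_le_sum fun i _ => E.measure_preimage_nb_le hpmp i hS).trans ?_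
      rw [Finset.sum_const, Finset.card_univ, Fintype.card_fin, nsmul_eq_mul, mul_assoc]
    refine hle.trans ?_
    rw [← ofReal_measureReal (measure_ne_top μ S)]
    have h3 : (1 + d * d : ENNReal) = ENNReal.ofReal (1 + d * d) := by
      rw [ENNReal.ofReal_add (by norm_num) (by positivity), ENNReal.ofReal_mul (by positivity)]
      simp
    rw [h3, ← ENNReal.ofReal_mul (by positivity)]
    refine ENNReal.ofReal_le_ofReal ?_
    have := (lt_min_iff.1 hμS).1
    rw [lt_div_iff₀ (by positivity)] at this
    linarith
  have hμS2 : μ S ≤ ENNReal.ofReal δ₂ := by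
    rw [← ofReal_measureReal (measure_ne_top μ S)]
    exact ENNReal.ofReal_le_ofReal (lt_min_iff.1 hμS).2.le
  let u : X → ℂ := fun x => A.indicator (fun _ => 1) x - B.indicator (fun _ => 1) x
  have huA {x : X} (hx : x ∈ A) : u x = 1 := by
    have : x ∉ B := fun h => disjoint_left.1 hAB hx h
    simp [u, hx, this]
  have huB {x : X} (hx : x ∈ B) : u x = -1 := by
    have : x ∉ A := fun h => disjoint_left.1 hAB h hx
    simp [u, hx, this]
  have hu1 (x : X) : ‖u x‖ ≤ 1 := by
    by_cases h1 : x ∈ A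
    · simp [huA h1]
    by_cases h2 : x ∈ B
    · simp [huB h2]
    simp [u, h1, h2]
  have huS {x : X} (hx : x ∉ S) : ‖u x‖ = 1 := by
    rcases hnS hx with h | h
    · simp [huA h]
    · simp [huB h]
  have huadj {x y : X} (hx : x ∉ S) (hy : y ∉ S) (hxy : G.Adj x y) : u y + u x = 0 := by
    rcases hnS hx with h | h <;> rcases hnS hy with h' | h'
    · exact (hAi h h' hxy.ne hxy).elim
    · simp [huA h, huB h']
    · simp [huB h, huA h']
    · exact (hBi h h' hxy.ne hxy).elim
  refine ⟨u, ?_, hu1, fun g v hg hv => ⟨?_, ?_⟩⟩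
  · exact (aestronglyMeasurable_const.indicator₀ hA).sub (aestronglyMeasurable_const.indicator₀ hB)
  · have hgn := ae_all_iff.2 fun i => (E.quasiMeasurePreserving_nb hpmp i).ae hg
    have hb : ∀ᵐ x ∂μ, ‖(adjacencyOperator G μ g + v) x‖ ≤ ‖S'.indicator F x‖ := by
      filter_upwards [E.adjacencyOperator_apply hpmp g, E.adjacencyOperator_apply hpmp f, hgn, hv,
        Lp.coeFn_add (adjacencyOperator G μ g) v, E.ae_mem] with x h1 h2 h3 h4 h5 hx
      rw [h5, Pi.add_apply, h1, h4, h2, Finset.mul_sum, ← Finset.sum_add_distrib]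
      simp_rw [h3, ← add_mul]
      by_cases hxS : x ∈ S'
      · rw [indicator_of_mem hxS, Real.norm_of_nonneg (by positivity)]
        refine (norm_sum_le _ _).trans ?_
        simp only [F]
        rw [Finset.mul_sum]
        refine Finset.sum_le_sum fun i _ => ?_
        rw [norm_mul]
        gcongr
        exact (norm_add_le _ _).trans (by linarith [hu1 x, hu1 (E.nb i x)])
      · have hz (i : Fin d) : u (E.nb i x) + u x = 0 :=
          huadj (fun h => hxS (Or.inl h)) (fun h => hxS (Or.inr (mem_iUnion.2 ⟨i, h⟩)))
            (E.adj_nb hx i)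
        simp [hz]
    rw [Lp.norm_def]
    exact ENNReal.toReal_le_of_le_ofReal hκ.le ((eLpNorm_mono_ae hb).trans (h₁ S' hS' hμS'))
  -- Since |u| = 1 off `S`, passing from f to uf loses at most the norm of f on `S`.
  · have hi : MemLp (S.indicator f) 2 μ := (Lp.memLp f).indicator hS
    have hin : ‖hi.toLp‖ ≤ κ := by
      rw [Lp.norm_toLp]
      exact ENNReal.toReal_le_of_le_ofReal hκ.le (h₂ S hS hμS2)
    have hsub : ‖f - hi.toLp‖ ≤ ‖g‖ := by
      refine Lp.norm_le_norm_of_ae_le ?_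
      filter_upwards [Lp.coeFn_sub f hi.toLp, hi.coeFn_toLp, hg] with x h1 h2 h3
      rw [h1, Pi.sub_apply, h2, h3]
      by_cases hx : x ∈ S
      · simp only [hx, Set.indicator_of_mem, sub_self, norm_zero]
        positivity
      · simp [hx, huS hx]
    calc ‖f‖ = ‖(f - hi.toLp) + hi.toLp‖ := by rw [sub_add_cancel]
      _ ≤ ‖f - hi.toLp‖ + ‖hi.toLp‖ := norm_add_le _ _
      _ ≤ ‖g‖ + κ := add_le_add hsub hin

/-- If -z were not a spectral value, T + z would be bounded below. Testing it on uf bounds z - T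
below at f with the same constant, up to arbitrarily small error, so z - T would be invertible. -/
theorem hasSymmetricSpectrum_of_isApproxMeasurablyBipartite (E : NeighborEnumeration G μ d)
    [IsProbabilityMeasure μ]
    (hpmp : IsPMPGraph G μ) (hbip : IsApproxMeasurablyBipartite G μ) :
    HasSymmetricSpectrum G μ := by
  intro z hz
  set T := adjacencyOperator G μ with hTdef
  have hT : IsSelfAdjoint T := E.isSelfAdjoint_adjacencyOperator hpmp
  have hzr : (starRingEnd ℂ) z = z := by
    rw [hT.mem_spectrum_eq_re hz]; simp
  have hSa (w : ℂ) (hw : (starRingEnd ℂ) w = w) :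
      IsSelfAdjoint (algebraMap ℂ (Lp ℂ 2 μ →L[ℂ] Lp ℂ 2 μ) w - T) := by
    refine IsSelfAdjoint.sub ?_ hT
    rw [Algebra.algebraMap_eq_smul_one]
    exact IsSelfAdjoint.smul hw (.one _)
  by_contra hneg
  rw [spectrum.notMem_iff] at hneg
  rw [spectrum.mem_iff] at hz
  obtain ⟨U, hU⟩ := hneg
  obtain ⟨c, hc, hbd⟩ : ∃ c > 0, ∀ g : Lp ℂ 2 μ, c * ‖g‖ ≤ ‖T g + z • g‖ := by
    refine ⟨(‖(↑U⁻¹ : Lp ℂ 2 μ →L[ℂ] Lp ℂ 2 μ)‖ + 1)⁻¹, by positivity, fun g => ?_⟩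
    rw [inv_mul_le_iff₀ (by positivity)]
    have h1 : (↑U⁻¹ : Lp ℂ 2 μ →L[ℂ] Lp ℂ 2 μ) ((U : Lp ℂ 2 μ →L[ℂ] Lp ℂ 2 μ) g) = g := by
      have := congrArg (fun S : Lp ℂ 2 μ →L[ℂ] Lp ℂ 2 μ => S g) U.inv_mul
      exact this
    have h2 : ‖(U : Lp ℂ 2 μ →L[ℂ] Lp ℂ 2 μ) g‖ = ‖T g + z • g‖ := by
      rw [hU, Algebra.algebraMap_eq_smul_one, ← norm_neg]
      congr 1
      simp
    rw [← h2]
    conv_lhs => rw [← h1]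
    refine ((↑U⁻¹ : Lp ℂ 2 μ →L[ℂ] Lp ℂ 2 μ).le_opNorm _).trans ?_
    gcongr
    linarith
  refine hz ((hSa z hzr).isUnit_of_bounded_below hc fun f => ?_)
  refine le_of_forall_pos_le_add fun η hη => ?_
  -- The anticommutation error κ and the norm loss cκ must add up to η.
  have hκ : 0 < η / (1 + c) := by positivity
  obtain ⟨u, hum, hu1, hu⟩ := E.exists_sign hpmp hbip f hκ
  have hmul (h : Lp ℂ 2 μ) : MemLp (fun x => u x * h x) 2 μ :=
    (Lp.memLp h).of_le (hum.mul (Lp.aestronglyMeasurable h)) (.of_forall fun x => by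
      rw [norm_mul]
      exact mul_le_of_le_one_left (norm_nonneg _) (hu1 x))
  obtain ⟨h1, h2⟩ := hu (hmul f).toLp (hmul (T f)).toLp (hmul f).coeFn_toLp (hmul (T f)).coeFn_toLp
  set g := (hmul f).toLp with hg
  set v := (hmul (T f)).toLp with hv
  have h3 : ‖z • g - v‖ ≤ ‖z • f - T f‖ := by
    refine Lp.norm_le_norm_of_ae_le ?_
    filter_upwards [Lp.coeFn_sub (z • g) v, Lp.coeFn_smul z g, Lp.coeFn_sub (z • f) (T f),
      Lp.coeFn_smul z f, (hmul f).coeFn_toLp, (hmul (T f)).coeFn_toLp] with x e1 e2 e3 e4 e5 e6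
    rw [e1, Pi.sub_apply, e2, Pi.smul_apply, e5, e6, e3, Pi.sub_apply, e4, Pi.smul_apply,
      smul_eq_mul, smul_eq_mul, show z * (u x * f x) - u x * (T f) x = u x * (z * f x - (T f) x) by
        ring, norm_mul]
    exact mul_le_of_le_one_left (norm_nonneg _) (hu1 x)
  have h4 : ‖T g + z • g‖ ≤ η / (1 + c) + ‖z • f - T f‖ := by
    have : T g + z • g = (T g + v) + (z • g - v) := by abel
    rw [this]
    exact (norm_add_le _ _).trans (add_le_add h1 h3)
  have h5 : (algebraMap ℂ (Lp ℂ 2 μ →L[ℂ] Lp ℂ 2 μ) z - T) f = z • f - T f := by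
    rw [Algebra.algebraMap_eq_smul_one]; rfl
  rw [h5]
  have h6 := hbd g
  have h7 : c * ‖f‖ ≤ c * (‖g‖ + η / (1 + c)) := mul_le_mul_of_nonneg_left h2 hc.le
  have h8 : η / (1 + c) * (1 + c) = η := div_mul_cancel₀ _ (by positivity)
  linarith

theorem natCast_mem_spectrum (E : NeighborEnumeration G μ d) [IsProbabilityMeasure μ]
    (hpmp : IsPMPGraph G μ) : (d : ℂ) ∈ spectrum ℂ (adjacencyOperator G μ) := by
  have h1 : MemLp (fun _ : X => (1 : ℂ)) 2 μ := memLp_const 1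
  have hT : adjacencyOperator G μ h1.toLp = (d : ℂ) • h1.toLp := by
    ext1
    have := ae_all_iff.2 fun i => (E.quasiMeasurePreserving_nb hpmp i).ae h1.coeFn_toLp
    filter_upwards [E.adjacencyOperator_apply hpmp h1.toLp, Lp.coeFn_smul (d : ℂ) h1.toLp,
      h1.coeFn_toLp, this] with x e1 e2 e3 e4
    rw [e1, e2, Pi.smul_apply, e3, Finset.sum_congr rfl fun i _ => e4 i]
    simp
  have hne : h1.toLp ≠ 0 := by
    intro h0
    have h2 := h1.coeFn_toLp
    rw [h0] at h2
    obtain ⟨x, hx, hx'⟩ := (h2.and (Lp.coeFn_zero ℂ 2 μ)).exists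
    rw [hx'] at hx
    exact zero_ne_one hx
  rw [spectrum.mem_iff]
  rintro ⟨U, hU⟩
  refine hne ?_
  have h3 : (↑U⁻¹ : Lp ℂ 2 μ →L[ℂ] Lp ℂ 2 μ) ((U : Lp ℂ 2 μ →L[ℂ] Lp ℂ 2 μ) h1.toLp) =
      h1.toLp := by
    have := congrArg (fun S : Lp ℂ 2 μ →L[ℂ] Lp ℂ 2 μ => S h1.toLp) U.inv_mul
    exact this
  rw [← h3, hU, sub_apply, hT, Algebra.algebraMap_eq_smul_one, smul_apply, one_apply_eq_self,
    sub_self, map_zero]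

end NeighborEnumeration

/-! ### Two-colorings and bipartitions -/

theorem IsApproxMeasurablyColorable.isApproxMeasurablyBipartite {X : Type*} [MeasurableSpace X]
    {G : SimpleGraph X} {μ : Measure X} {k : ℕ} (hk : k ≤ 2)
    (h : IsApproxMeasurablyColorable G μ k) : IsApproxMeasurablyBipartite G μ := by
  intro ε hε
  obtain ⟨A, -, hAε, c, hc⟩ := h ε hε
  -- Indexing classes by naturals treats k < 2 uniformly: surplus classes are empty.
  let S (j : ℕ) : Set X := {x | ∃ hx : x ∈ A, (c ⟨x, hx⟩ : ℕ) = j}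
  have hS (j : ℕ) : NullMeasurableSet (S j) μ := by
    by_cases hj : j < k
    · convert hc ⟨j, hj⟩ using 1
      ext x
      simp [S, Fin.ext_iff]
    · convert! nullMeasurableSet_empty using 1
      refine Set.eq_empty_of_forall_notMem ?_
      rintro x ⟨hx, rfl⟩
      exact hj (c ⟨x, hx⟩).2
  have hSi (j : ℕ) : G.IsIndepSet (S j) := by
    rintro x ⟨hx, hxj⟩ y ⟨hy, hyj⟩ - hxy
    exact c.valid (v := ⟨x, hx⟩) (w := ⟨y, hy⟩) hxy (Fin.ext (hxj.trans hyj.symm))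
  refine ⟨S 0, S 1, hS 0, hS 1, ?_, hSi 0, hSi 1, ?_⟩
  · rw [Set.disjoint_left]
    rintro x ⟨hx, h0⟩ ⟨hx', h1⟩
    omega
  · have : S 0 ∪ S 1 = A := by
      ext x
      constructor
      · rintro (⟨hx, -⟩ | ⟨hx, -⟩) <;> exact hx
      · intro hx
        have := (c ⟨x, hx⟩).2
        have h01 : (c ⟨x, hx⟩ : ℕ) = 0 ∨ (c ⟨x, hx⟩ : ℕ) = 1 := by omega
        exact h01.imp (fun h => ⟨hx, h⟩) fun h => ⟨hx, h⟩
    rwa [this]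

theorem IsApproxMeasurablyBipartite.isApproxMeasurablyColorable {X : Type*} [MeasurableSpace X]
    {G : SimpleGraph X} {μ : Measure X} (h : IsApproxMeasurablyBipartite G μ) :
    IsApproxMeasurablyColorable G μ 2 := by
  classical
  intro ε hε
  obtain ⟨A, B, hA, hB, hAB, hAi, hBi, hlt⟩ := h ε hε
  -- A coloring needs a Borel domain, while A ∪ B is only μ-measurable.
  obtain ⟨C, hCs, hC, hCe⟩ := (hA.union hB).exists_measurable_subset_ae_eq
  have hB' {x : X} (hx : x ∈ C) (hxA : x ∉ A) : x ∈ B := (hCs hx).resolve_left hxA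
  let col : C → Fin 2 := fun x => if (x : X) ∈ A then 0 else 1
  have hcol : ∀ {v w}, (G.induce C).Adj v w → col v ≠ col w := by
    rintro ⟨x, hx⟩ ⟨y, hy⟩ (hxy : G.Adj x y)
    by_cases hxA : x ∈ A <;> by_cases hyA : y ∈ A
    · exact (hAi hxA hyA hxy.ne hxy).elim
    · simp [col, hxA, hyA]
    · simp [col, hxA, hyA]
    · exact (hBi (hB' hx hxA) (hB' hy hyA) hxy.ne hxy).elim
  refine ⟨C, hC, by rwa [measureReal_congr hCe], SimpleGraph.Coloring.mk col hcol, fun i => ?_⟩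
  change NullMeasurableSet (Subtype.val '' {a : C | col a = i}) μ
  fin_cases i
  · convert! hC.nullMeasurableSet.inter hA using 1
    ext x
    by_cases hxA : x ∈ A <;> simp [col, hxA]
  · convert! hC.nullMeasurableSet.diff hA using 1
    ext x
    by_cases hxA : x ∈ A <;> simp [col, hxA]

theorem approxMeasurableChromaticNumber_le_two_iff {X : Type*} [MeasurableSpace X]
    {G : SimpleGraph X} {μ : Measure X} :
    approxMeasurableChromaticNumber G μ ≤ 2 ↔ IsApproxMeasurablyBipartite G μ := by
  constructor
  · intro h
    -- A strict bound on the infimum yields a witness k < 3.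
    have hlt : approxMeasurableChromaticNumber G μ < 3 := lt_of_le_of_lt h (by norm_num)
    simp only [approxMeasurableChromaticNumber, iInf_lt_iff] at hlt
    obtain ⟨k, hk, hk3⟩ := hlt
    have : k < 3 := by exact_mod_cast hk3
    exact IsApproxMeasurablyColorable.isApproxMeasurablyBipartite (by omega) hk
  · intro h
    exact iInf₂_le (2 : ℕ) h.isApproxMeasurablyColorable

/-! ### The main theorem -/

theorem theorem4p2 {X : Type*} [MeasurableSpace X] [StandardBorelSpace X]
    (μ : Measure X) [IsProbabilityMeasure μ] (G : SimpleGraph X) (d : ℕ)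
    (hBorel : IsBorelGraph G) (hpmp : IsPMPGraph G μ) (herg : IsErgodicGraph G μ)
    (hreg : IsRegularGraph G μ d) :
    IsAdjacencyOperator G μ (adjacencyOperator G μ) ∧
    (HasSpectralGap G μ d →
      (-(d : ℂ) ∈ spectrum ℂ (adjacencyOperator G μ) → IsApproxMeasurablyBipartite G μ) ∧
      [approxMeasurableChromaticNumber G μ ≤ 2,
        IsApproxMeasurablyBipartite G μ,
        HasSymmetricSpectrum G μ,
        -(d : ℂ) ∈ spectrum ℂ (adjacencyOperator G μ)].TFAE) := by
  obtain ⟨E⟩ := hreg.nonempty_neighborEnumeration hBorel hpmp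
  refine ⟨E.isAdjacencyOperator hpmp, ?_⟩
  rintro ⟨ε, hε, hσ⟩
  have hσ' : ∀ x ∈ spectrum ℝ (adjacencyOperator G μ), x ≤ d - ε ∨ x = d := by
    intro x hx
    obtain ⟨y, hy, hyx⟩ := hσ (spectrum.algebraMap_mem ℂ hx)
    have hxy : y = x := Complex.ofReal_injective hyx
    rw [hxy] at hy
    exact hy.imp (fun h => h.2) fun h => h
  have h42 := E.isApproxMeasurablyBipartite_of_gap hpmp herg hε hσ'
  refine ⟨h42, ?_⟩
  tfae_have 1 ↔ 2 := approxMeasurableChromaticNumber_le_two_iff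
  tfae_have 4 → 2 := h42
  tfae_have 2 → 3 := E.hasSymmetricSpectrum_of_isApproxMeasurablyBipartite hpmp
  tfae_have 3 → 4 := fun h => h _ (E.natCast_mem_spectrum hpmp)
  tfae_finish
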